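/- **Setting.** Let $\ell_1,\dots,\ell_d\ge 2$, $Q=\mathrm{diag}(\ell_1,\dots,\ell_d)$, $R=\prod_{i=1}^d\{0,\dots,\ell_i-1\}$, and let $\theta:\mathcal A\to\mathcal A^R$ be a block substitution on a finite alphabet $\mathcal A$, with columns $\theta_{n}(a)=\theta(a)_{n}$ ($n\in R$) and supertiles $\theta^k(a)$, supported on $\prod_i\{0,\dots,\ell_i^k-1\}$ and defined by $\theta^0(a)=a$ and $\theta^{k+1}(a)_{Qq+n}=\theta(\theta^k(a)_q)_n$. A pattern is *legal* if a translate of it occurs in some $\theta^k(a)$, $k\ge1$; $\mathbb X_\theta\subseteq\mathcal A^{\mathbb Z^d}$ is the set of configurations all of whose finite patterns are legal; $(\sigma_n x)_i=x_{i+n}$, and $\theta(x)_{Qq+n}=\theta(x_q)_n$ for $x\in\mathcal A^{\mathbb Z^d}$, $q\in\mathbb Z^d$, $n\in R$. Assume that $\theta$ is injective (as a map $\mathcal A\to\mathcal A^R$), primitive (for some $k\ge 1$ every $\theta^k(a)$ contains every letter) and aperiodic (no element of $\mathbb X_\theta$ has a nonzero period). Let $\mathbb Z_Q^d=\varprojlim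 \mathbb Z^d/Q^k\mathbb Z^d=\prod_{j}\mathbb Z_{\ell_j}$, where the $j$-th coordinate of $z$ has the base-$\ell_j$ expansion $\dots z^{(j)}_2z^{(j)}_1z^{(j)}_0$, and let $\pi_{\rm tile}:\mathbb X_\theta\to\mathbb Z_Q^d$ be the tiling factor: $\pi_{\rm tile}(x)$ is the (unique) $z$ such that for every $k$ there is $y\in\mathbb X_\theta$ with $x=\sigma_{t_k}\theta^k(y)$, where $t_k^{(j)}=\sum_{i<k}z^{(j)}_i\ell_j^i$. For $J\subseteq\{1,\dots,d\}$ let $B_J=\prod_{j\in J}\{-1,0\}\times\prod_{j\notin J}\{0\}$. The *$J$-derived substitution* $\partial_J\theta$ is the block substitution with support $R_J=\prod_{j\notin J}\{0,\dots,\ell_j-1\}$ whose alphabet $\mathcal A_J$ is the set of legal patterns with support $B_J$, and whose column with index $n\in R_J$ maps $P$ to the pattern $b\mapsto\theta_{n(b)}(P_b)$, where $n(b)_j=n_j$ for $j\notin J$, and for $j\in J$, $n(b)_j=\ell_j-1$ if $b_j=-1$ and $n(b)_j=0$ if $b_j=0$. The graph $\mathcal G(\theta,J)$ is the coincidence graph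 of $\partial_J\theta$: its vertices form the smallest family of subsets of $\mathcal A_J$ which contains $\mathcal A_J$ and is closed under images under columns of $\partial_J\theta$, and for each vertex $U$ and each $n\in R_J$ it has an edge labelled $n$ from $U$ to $(\partial_J\theta)_n(U)$. $\mathcal G(\theta,J)^{\rm op}$ is the same graph with all edges reversed. **Theorem.** Let $\theta$ be as above, let $z\in\mathbb Z_Q^d$, and let $J=\{j: z^{(j)}\in\mathbb Z\}$. Suppose that $J\ne\{1,\dots,d\}$. Then, for every integer $C\ge0$, the following are equivalent: (i) $|\pi_{\rm tile}^{-1}(z)|\ge C$; (ii) there is an infinite path $v_0\xrightarrow{e_0}v_1\xrightarrow{e_1}v_2\xrightarrow{e_2}\cdots$ in $\mathcal G(\theta,J)^{\rm op}$ such that for every $k$ the edge $e_k$ is labelled by the tuple $(z^{(j)}_k)_{j\notin J}$ of $k$-th digits of the non-integer coordinates of $z$, and which passes infinitely many times through vertices of cardinality at least $C$. -/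

import Mathlib

/-- A block substitution with index set `ι` of directions (so in `ℤ^ι`) on the alphabet `A`:
the expansive matrix is `diag (len i)`, the digit set is the box `∏ i, {0, …, len i - 1}`, and
`map a n` is the letter of `θ(a)` at position `n`, i.e. the `n`-th column evaluated at `a`. -/
structure BlockSubst (ι : Type*) (A : Type*) where
  len : ι → ℕ
  two_le_len : ∀ i, 2 ≤ len i
  map : A → (∀ i, Fin (len i)) → A

/-- The `ℓ`-adic integers as the inverse limit of the rings `ℤ / ℓ^k ℤ`. -/
structure AdicInt (ℓ : ℕ) where
  proj : ∀ k : ℕ, ZMod (ℓ ^ k)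
  compat : ∀ k, ZMod.castHom (pow_dvd_pow ℓ (Nat.le_succ k)) (ZMod (ℓ ^ k)) (proj (k + 1)) = proj k

namespace AdicInt

/-- The integer `N`, regarded as an `ℓ`-adic integer. -/
def ofInt (ℓ : ℕ) (N : ℤ) : AdicInt ℓ :=
  ⟨fun k => (N : ZMod (ℓ ^ k)), fun _ => map_intCast _ N⟩

instance (ℓ : ℕ) : Nonempty (AdicInt ℓ) := ⟨ofInt ℓ 0⟩

/-- `z` belongs to the copy of `ℤ` inside the `ℓ`-adic integers. -/
def IsInteger {ℓ : ℕ} (z : AdicInt ℓ) : Prop := ∃ N : ℤ, ofInt ℓ N = z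

/-- The number in `{0, …, ℓ^k - 1}` whose base-`ℓ` expansion is `z_{k-1} … z_1 z_0`. -/
def trunc {ℓ : ℕ} (z : AdicInt ℓ) (k : ℕ) : ℕ := (z.proj k).val

/-- The digit `z_k` of the base-`ℓ` expansion `… z_2 z_1 z_0`. -/
def digit {ℓ : ℕ} (hℓ : 2 ≤ ℓ) (z : AdicInt ℓ) (k : ℕ) : Fin ℓ :=
  ⟨z.trunc (k + 1) / ℓ ^ k, by
    have : NeZero (ℓ ^ (k + 1)) := ⟨pow_ne_zero _ (by omega)⟩
    have h : z.trunc (k + 1) < ℓ ^ (k + 1) := ZMod.val_lt _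
    exact Nat.div_lt_of_lt_mul ((pow_succ ℓ k) ▸ h)⟩

end AdicInt

/-- A directed graph (loops and multiple edges allowed) with vertices in `V` and edges labelled by
`L`; `edge u n v` says that there is an edge with label `n` from `u` to `v`. -/
structure LabelledGraph (V L : Type*) where
  verts : Set V
  edge : V → L → V → Prop
  edge_mem : ∀ u n v, edge u n v → u ∈ verts ∧ v ∈ verts

namespace LabelledGraph

/-- The graph with all edges reversed. -/
def op {V L : Type*} (G : LabelledGraph V L) : LabelledGraph V L where
  verts := G.verts
  edge u n v := G.edge v n u
  edge_mem u n v h := (G.edge_mem v n u h).symm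

/-- `v 0, v 1, v 2, …` are the successive vertices of an infinite path in `G` whose `k`-th edge,
from `v k` to `v (k + 1)`, carries the label `lab k`. -/
def IsInfinitePath {V L : Type*} (G : LabelledGraph V L) (lab : ℕ → L) (v : ℕ → V) : Prop :=
  ∀ k, G.edge (v k) (lab k) (v (k + 1))

end LabelledGraph

namespace BlockSubst

variable {ι A : Type*}

/-- The residue of a position modulo the supertile lattice, as an element of the digit set. -/
def res (θ : BlockSubst ι A) (p : ι → ℤ) : ∀ i, Fin (θ.len i) := fun i =>
  ⟨(p i % (θ.len i : ℤ)).toNat, by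
    have h := θ.two_le_len i
    have h1 := Int.emod_nonneg (p i) (b := (θ.len i : ℤ)) (by omega)
    have h2 := Int.emod_lt_of_pos (p i) (b := (θ.len i : ℤ)) (by omega)
    omega⟩

/-- The action of `θ` on configurations: the letter `x q` is replaced by the block `θ (x q)`,
placed with its lower corner at `Q q`. -/
def act (θ : BlockSubst ι A) (x : (ι → ℤ) → A) : (ι → ℤ) → A := fun p =>
  θ.map (x fun i => p i / (θ.len i : ℤ)) (θ.res p)

/-- The support `∏ i, {0, …, (len i)^k - 1}` of the level-`k` supertiles. -/
def supp (θ : BlockSubst ι A) (k : ℕ) : Set (ι → ℤ) :=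
  {p | ∀ i, 0 ≤ p i ∧ p i < (θ.len i : ℤ) ^ k}

/-- The letter of the level-`k` supertile `θ^k(a)` at position `p`; only the values at
positions in `θ.supp k` are ever used. -/
def supertile (θ : BlockSubst ι A) : ℕ → A → (ι → ℤ) → A
  | 0, a => fun _ => a
  | k + 1, a => fun p =>
      θ.map (θ.supertile k a fun i => p i / (θ.len i : ℤ)) (θ.res p)

/-- A pattern with support `B` is legal (belongs to the language of `θ`) if some translate of it
occurs in a supertile `θ^k(a)` with `k ≥ 1`. -/
def Legal (θ : BlockSubst ι A) {B : Set (ι → ℤ)} (P : B → A) : Prop :=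
  ∃ (a : A) (k : ℕ) (t : ι → ℤ), 1 ≤ k ∧
    ∀ b : B, (b : ι → ℤ) + t ∈ θ.supp k ∧ θ.supertile k a ((b : ι → ℤ) + t) = P b

/-- The shift space of `θ`: all configurations whose finite patterns are all legal. -/
def shiftSpace (θ : BlockSubst ι A) : Set ((ι → ℤ) → A) :=
  {x | ∀ B : Set (ι → ℤ), B.Finite → θ.Legal (fun b : B => x b)}

/-- Some power of `θ` sends every letter to a block containing every letter. -/
def IsPrimitive (θ : BlockSubst ι A) : Prop :=
  ∃ k : ℕ, 1 ≤ k ∧ ∀ a b : A, ∃ p ∈ θ.supp k, θ.supertile k a p = b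

/-- The shift by `n`. -/
def shift (n : ι → ℤ) (x : (ι → ℤ) → A) : (ι → ℤ) → A := fun p => x (p + n)

/-- No element of the shift space has a non-zero period. -/
def IsAperiodic (θ : BlockSubst ι A) : Prop :=
  ∀ x ∈ θ.shiftSpace, ∀ n : ι → ℤ, shift n x = x → n = 0

/-- The odometer `ℤ_Q^d`, i.e. the inverse limit of `ℤ^d / Q^k ℤ^d`; as `Q` is diagonal this is
the product of the `AdicInt (len i)`. -/
abbrev Odometer (θ : BlockSubst ι A) : Type _ := ∀ i, AdicInt (θ.len i)

/-- For every `k`, the first `k` digits of `z` give the position of the origin in the level-`k`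
supertile of `x` that contains it: `x = σ_t (θ^k y)` with `y` in the shift space and `t` the
element of the support of `θ^k` with these digits. -/
def IsTileAddress (θ : BlockSubst ι A) (x : (ι → ℤ) → A) (z : θ.Odometer) : Prop :=
  ∀ k : ℕ, ∃ y ∈ θ.shiftSpace, x = shift (fun i => ((z i).trunc k : ℤ)) (θ.act^[k] y)

/-- The tiling factor `π_tile`, sending `x` to its tile address. (For an injective, primitive and
aperiodic `θ` each point of the shift space has exactly one address, by recognizability.) -/
noncomputable def piTile (θ : BlockSubst ι A) (x : θ.shiftSpace) : θ.Odometer :=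
  Classical.epsilon fun z => θ.IsTileAddress x z

/-- The family of sets of letters that are vertices of the coincidence graph: the smallest one
that contains the alphabet and is closed under taking images under columns. -/
inductive IsCoincidenceVertex (θ : BlockSubst ι A) : Set A → Prop
  | alphabet : IsCoincidenceVertex θ Set.univ
  | column (U : Set A) (n : ∀ i, Fin (θ.len i)) (hU : IsCoincidenceVertex θ U) :
      IsCoincidenceVertex θ ((fun a => θ.map a n) '' U)

/-- The coincidence graph of `θ`: every vertex `U` has, for each `n` in the digit set, one edge
labelled `n`, going to the image of `U` under the `n`-th column. -/
def coincidenceGraph (θ : BlockSubst ι A) : LabelledGraph (Set A) (∀ i, Fin (θ.len i)) where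
  verts := {U | θ.IsCoincidenceVertex U}
  edge U n V := θ.IsCoincidenceVertex U ∧ V = (fun a => θ.map a n) '' U
  edge_mem := by
    rintro U n V ⟨hU, rfl⟩
    exact ⟨hU, .column U n hU⟩

/-- The set `B_J = ∏_{j ∈ J} {-1, 0} × ∏_{j ∉ J} {0}`. -/
def cornerBox (J : Set ι) : Set (ι → ℤ) :=
  {b | (∀ j ∈ J, b j = -1 ∨ b j = 0) ∧ ∀ j ∉ J, b j = 0}

/-- The alphabet of the `J`-derived substitution: the legal patterns with support `B_J`. -/
def DerivedLetter (θ : BlockSubst ι A) (J : Set ι) : Type _ :=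
  {P : cornerBox J → A // θ.Legal P}

open Classical in
/-- The column of `θ` that is applied at position `b` of `B_J`: in the directions `j ∈ J` it is
the last one if `b j = -1` and the first one if `b j = 0`; in the other directions it is `n`. -/
noncomputable def cornerDigit (θ : BlockSubst ι A) (J : Set ι)
    (n : ∀ j : {j // j ∉ J}, Fin (θ.len j)) (b : ι → ℤ) : ∀ i, Fin (θ.len i) := fun i =>
  have h2 := θ.two_le_len i
  if h : i ∈ J then
    (if b i = -1 then ⟨θ.len i - 1, by omega⟩ else ⟨0, by omega⟩)
  else n ⟨i, h⟩

theorem legal_corner (θ : BlockSubst ι A) (J : Set ι)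
    (n : ∀ j : {j // j ∉ J}, Fin (θ.len j)) {P : cornerBox J → A} (hP : θ.Legal P) :
    θ.Legal (fun b : cornerBox J => θ.map (P b) (θ.cornerDigit J n b)) := by
  classical
  obtain ⟨a, k, t, hk, h⟩ := hP
  refine ⟨a, k + 1, fun i => (θ.len i : ℤ) * t i + (if hi : i ∈ J then 0 else (n ⟨i, hi⟩ : ℕ)),
    by omega, fun b => ?_⟩
  have key : ∀ i, ∃ r : ℤ, 0 ≤ r ∧ r < θ.len i ∧ r = ((θ.cornerDigit J n b i : ℕ) : ℤ) ∧
      (b : ι → ℤ) i + ((θ.len i : ℤ) * t i + (if hi : i ∈ J then 0 else (n ⟨i, hi⟩ : ℕ)))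
        = (θ.len i : ℤ) * ((b : ι → ℤ) i + t i) + r := by
    intro i
    have h2 := θ.two_le_len i
    by_cases hi : i ∈ J
    · rcases b.2.1 i hi with hb | hb
      · refine ⟨θ.len i - 1, by omega, by omega, ?_, ?_⟩
        · simp only [cornerDigit, hi, hb, dif_pos, if_pos]
          omega
        · simp only [hi, hb, dif_pos]
          ring
      · refine ⟨0, by omega, by omega, ?_, ?_⟩
        · simp [cornerDigit, hi, hb]
        · simp [hi, hb]
    · have hb := b.2.2 i hi
      refine ⟨(n ⟨i, hi⟩ : ℕ), by omega, by exact_mod_cast (n ⟨i, hi⟩).2, ?_, ?_⟩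
      · simp [cornerDigit, hi]
      · simp [hi, hb]
  have hdiv : ∀ i, ((b : ι → ℤ) i + ((θ.len i : ℤ) * t i +
      (if hi : i ∈ J then 0 else (n ⟨i, hi⟩ : ℕ)))) / (θ.len i : ℤ) = (b : ι → ℤ) i + t i := by
    intro i
    obtain ⟨r, h0, h1, -, h3⟩ := key i
    rw [h3, Int.mul_add_ediv_left _ _ (by omega), Int.ediv_eq_zero_of_lt h0 h1, add_zero]
  obtain ⟨hs, hv⟩ := h b
  constructor
  · intro i
    obtain ⟨r, h0, h1, -, h3⟩ := key i
    obtain ⟨q0, q1⟩ := hs i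
    simp only [Pi.add_apply] at q0 q1 ⊢
    rw [h3]
    refine ⟨by positivity, ?_⟩
    rw [pow_succ]
    nlinarith
  · have hres : θ.res ((b : ι → ℤ) + fun i => (θ.len i : ℤ) * t i +
        (if hi : i ∈ J then 0 else (n ⟨i, hi⟩ : ℕ))) = θ.cornerDigit J n b := by
      funext i
      obtain ⟨r, h0, h1, h2, h3⟩ := key i
      apply Fin.ext
      simp only [res, Pi.add_apply]
      rw [h3, Int.mul_add_emod_self_left, Int.emod_eq_of_lt h0 h1, h2, Int.toNat_natCast]
    simp only [supertile]
    rw [hres]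
    congr 1
    rw [← hv]
    congr 1
    funext i
    exact hdiv i

/-- The `J`-derived substitution: a block substitution in the directions outside `J`, on the
alphabet of legal patterns with support `B_J`. The level-1 supertiles of the letters of such a
pattern meet along a common face, and its image records the patterns with support `B_J` along
this face. -/
noncomputable def derived (θ : BlockSubst ι A) (J : Set ι) :
    BlockSubst {j // j ∉ J} (θ.DerivedLetter J) where
  len j := θ.len j
  two_le_len j := θ.two_le_len j
  map P n := ⟨fun b => θ.map (P.1 b) (θ.cornerDigit J n b), θ.legal_corner J n P.2⟩

/-- The tuple of the `k`-th digits of `z` in the directions outside `J`. -/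
def digitLabel (θ : BlockSubst ι A) (J : Set ι) (z : θ.Odometer) (k : ℕ) :
    ∀ j : {j // j ∉ J}, Fin (θ.len j) :=
  fun j => (z j).digit (θ.two_le_len j) k

end BlockSubst

/-!
The fibre of the tiling factor over `z` is an inverse limit of finite sets, whose transition maps
are the columns of the derived substitution labelled by the digits of `z`; its cardinality can then
be read off from the coincidence graph.

**The fibre consists of the points with tile address `z`** (`piTile_eq_iff`). Existence of an address
is desubstitution, which follows by a limit argument. Uniqueness is recognizability
(`exists_scale_of_shift_act_eq`). If `σ_δ θ(x) = θ(x')` for some `δ ∉ Qℤ^d`, then by minimality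
`σ_δ θ(y) ∈ θ(𝕏)` for every `y ∈ 𝕏`, so every point lies in two different translates `σ_r θ(𝕏)` modulo
`Qℤ^d`, and by iteration in at least `2 ^ k` translates `σ_t θ^k(𝕏)` modulo `Q^kℤ^d`
(`two_pow_le_encard_offsets`). But the number of these translates is bounded independently of `k`
(`encard_offsets_le`): two points `y`, `y'` with `θ^k(y') = σ_s θ^k(y)`, where `s` is smaller than
the level-`k` supertiles, are related by a local rule on the window `{-1, 0, 1}^d`, there are only
finitely many such rules, and two offsets with the same rule differ by a period.

**The fibre is an inverse limit** (`encard_preimage_piTile`). A point with address `z` is a sequence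
of successive desubstitutions `y 0, y 1, …` whose offsets are the digits of `z`; in the directions
`J` the integer coordinates themselves are used instead of truncations, so that these offsets
vanish. The supertiles of level `m` with indices in the corner box `B_J` exhaust `ℤ^d`, since the
digits of a non-integer are neither eventually `0` nor eventually `ℓ - 1`
(`eventually_carry_mem_cornerBox`). So the sequence is determined by the patterns of the `y k` on
`B_J`, and each sequence of legal patterns `P k` in which `P k` is the image of `P (k + 1)` under the
column labelled by the `k`-th digits arises (`bijOn_cornerPattern`).

**Counting** (`le_encard_columnLimit_iff`). The sets of letters that remain after many columns
stabilize; they are vertices and form a path in the reversed graph, and distinct points of the limit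
have distinct `k`-th coordinates for large `k`. Conversely each letter of a vertex on such a path
extends to a point of the limit.
-/

namespace BlockSubst

variable {ι A : Type*}

/-! ### Supertiles, shifts and the action on configurations -/

/-- The expansion `Q^k p`. -/
def scale (θ : BlockSubst ι A) (k : ℕ) (p : ι → ℤ) : ι → ℤ := fun i => (θ.len i : ℤ) ^ k * p i

/-- The index `⌊Q^{-k} p⌋` of the level-`k` supertile that contains the position `p`. -/
def coarse (θ : BlockSubst ι A) (k : ℕ) (p : ι → ℤ) : ι → ℤ := fun i => p i / (θ.len i : ℤ) ^ k

theorem len_pos (θ : BlockSubst ι A) (i : ι) : (0 : ℤ) < θ.len i := by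
  have := θ.two_le_len i
  omega

theorem len_pow_pos (θ : BlockSubst ι A) (k : ℕ) (i : ι) : (0 : ℤ) < (θ.len i : ℤ) ^ k :=
  pow_pos (θ.len_pos i) k

theorem shift_shift (m n : ι → ℤ) (x : (ι → ℤ) → A) : shift m (shift n x) = shift (m + n) x := by
  funext p
  simp only [shift, add_assoc]

theorem shift_zero (x : (ι → ℤ) → A) : shift 0 x = x := by
  funext p
  simp [shift]

theorem coarse_zero (θ : BlockSubst ι A) (p : ι → ℤ) : θ.coarse 0 p = p := by
  funext i
  simp [coarse]

theorem scale_zero (θ : BlockSubst ι A) (p : ι → ℤ) : θ.scale 0 p = p := by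
  funext i
  simp [scale]

theorem coarse_coarse (θ : BlockSubst ι A) (k m : ℕ) (p : ι → ℤ) :
    θ.coarse k (θ.coarse m p) = θ.coarse (m + k) p := by
  funext i
  simp only [coarse, pow_add]
  rw [Int.ediv_ediv_of_nonneg (θ.len_pow_pos m i).le]

theorem scale_scale (θ : BlockSubst ι A) (k m : ℕ) (p : ι → ℤ) :
    θ.scale k (θ.scale m p) = θ.scale (k + m) p := by
  funext i
  simp only [scale, pow_add, mul_assoc]

theorem scale_add (θ : BlockSubst ι A) (k : ℕ) (p q : ι → ℤ) :
    θ.scale k (p + q) = θ.scale k p + θ.scale k q := by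
  funext i
  simp only [scale, Pi.add_apply, mul_add]

theorem scale_injective (θ : BlockSubst ι A) (k : ℕ) : Function.Injective (θ.scale k) := by
  intro p q h
  funext i
  exact mul_left_cancel₀ (θ.len_pow_pos k i).ne' (congrFun h i)

theorem coarse_scale_add (θ : BlockSubst ι A) (k : ℕ) (p q : ι → ℤ) :
    θ.coarse k (θ.scale k p + q) = p + θ.coarse k q := by
  funext i
  simp only [coarse, scale, Pi.add_apply]
  rw [Int.mul_add_ediv_left _ _ (θ.len_pow_pos k i).ne']

theorem coarse_of_mem_supp (θ : BlockSubst ι A) {k : ℕ} {p : ι → ℤ} (hp : p ∈ θ.supp k) :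
    θ.coarse k p = 0 := by
  funext i
  exact Int.ediv_eq_zero_of_lt (hp i).1 (hp i).2

theorem mem_supp_of_coarse (θ : BlockSubst ι A) {k : ℕ} {p : ι → ℤ} (hp : θ.coarse k p = 0) :
    p ∈ θ.supp k := by
  intro i
  have h := congrFun hp i
  simp only [coarse, Pi.zero_apply] at h
  have hl := θ.len_pow_pos k i
  have h1 := Int.emod_nonneg (p i) hl.ne'
  have h2 := Int.emod_lt_of_pos (p i) hl
  have h3 := Int.emod_add_mul_ediv (p i) ((θ.len i : ℤ) ^ k)
  rw [h] at h3
  constructor <;> linarith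

theorem mem_supp_iff (θ : BlockSubst ι A) {k : ℕ} {p : ι → ℤ} :
    p ∈ θ.supp k ↔ θ.coarse k p = 0 :=
  ⟨θ.coarse_of_mem_supp, θ.mem_supp_of_coarse⟩

theorem finite_supp [Finite ι] (θ : BlockSubst ι A) (k : ℕ) : (θ.supp k).Finite := by
  refine (Set.Finite.pi' fun i => Set.finite_Ico (0 : ℤ) ((θ.len i : ℤ) ^ k)).subset ?_
  intro p hp i
  exact ⟨(hp i).1, (hp i).2⟩

/-- The offset of `p` in the level-`k` supertile that contains it. -/
theorem exists_eq_scale_add (θ : BlockSubst ι A) (k : ℕ) (p : ι → ℤ) :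
    ∃ r ∈ θ.supp k, p = θ.scale k (θ.coarse k p) + r := by
  refine ⟨fun i => p i % (θ.len i : ℤ) ^ k, fun i => ⟨Int.emod_nonneg _ (θ.len_pow_pos k i).ne',
    Int.emod_lt_of_pos _ (θ.len_pow_pos k i)⟩, ?_⟩
  funext i
  exact (Int.mul_ediv_add_emod (p i) ((θ.len i : ℤ) ^ k)).symm

theorem scale_add_mem_supp (θ : BlockSubst ι A) {k m : ℕ} {p r : ι → ℤ} (hp : p ∈ θ.supp m)
    (hr : r ∈ θ.supp k) : θ.scale k p + r ∈ θ.supp (k + m) := by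
  rw [mem_supp_iff] at *
  rw [← coarse_coarse, coarse_scale_add, hr, add_zero, hp]

theorem act_apply (θ : BlockSubst ι A) (x : (ι → ℤ) → A) (p : ι → ℤ) :
    θ.act x p = θ.map (x (θ.coarse 1 p)) (θ.res p) := by
  have h : (fun i => p i / (θ.len i : ℤ)) = θ.coarse 1 p := by
    funext i
    rw [coarse, pow_one]
  rw [act, h]

theorem act_supertile (θ : BlockSubst ι A) (k : ℕ) (a : A) :
    θ.act (θ.supertile k a) = θ.supertile (k + 1) a := rfl

theorem act_iterate_const (θ : BlockSubst ι A) (k : ℕ) (a : A) :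
    θ.act^[k] (fun _ => a) = θ.supertile k a := by
  induction k with
  | zero => rfl
  | succ k ih => rw [Function.iterate_succ_apply', ih, act_supertile]

theorem act_iterate_apply (θ : BlockSubst ι A) (k : ℕ) (x : (ι → ℤ) → A) (p : ι → ℤ) :
    θ.act^[k] x p = θ.supertile k (x (θ.coarse k p)) p := by
  induction k generalizing p with
  | zero => simp [supertile, coarse_zero]
  | succ k ih =>
    rw [Function.iterate_succ_apply', act_apply, ih, coarse_coarse, add_comm 1 k,
      ← act_supertile, act_apply]

theorem res_scale_add (θ : BlockSubst ι A) (n p : ι → ℤ) :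
    θ.res (θ.scale 1 n + p) = θ.res p := by
  funext i
  simp [res, scale]

theorem act_shift (θ : BlockSubst ι A) (n : ι → ℤ) (x : (ι → ℤ) → A) :
    θ.act (shift n x) = shift (θ.scale 1 n) (θ.act x) := by
  funext p
  simp only [shift, act_apply]
  rw [add_comm p, res_scale_add, coarse_scale_add, add_comm n]

theorem act_iterate_shift (θ : BlockSubst ι A) (k : ℕ) (n : ι → ℤ) (x : (ι → ℤ) → A) :
    θ.act^[k] (shift n x) = shift (θ.scale k n) (θ.act^[k] x) := by
  induction k with
  | zero => simp [scale_zero]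
  | succ k ih =>
    rw [Function.iterate_succ_apply', ih, act_shift, scale_scale, add_comm 1 k,
      Function.iterate_succ_apply']

theorem supertile_scale_add (θ : BlockSubst ι A) (k : ℕ) (a : A) (n p : ι → ℤ) :
    θ.supertile k a (θ.scale k n + p) = θ.supertile k a p := by
  have h := congrFun (θ.act_iterate_shift k n (fun _ => a)) p
  have h' : shift n (fun _ : ι → ℤ => a) = fun _ => a := rfl
  rw [h', act_iterate_const, shift, add_comm] at h
  exact h.symm

/-- The letter of `θ^k(x)` in the supertile of index `n` at offset `p`. -/
theorem act_iterate_scale_add (θ : BlockSubst ι A) (k : ℕ) (x : (ι → ℤ) → A) (n p : ι → ℤ) :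
    θ.act^[k] x (θ.scale k n + p) = θ.supertile k (x (n + θ.coarse k p)) p := by
  rw [act_iterate_apply, coarse_scale_add, supertile_scale_add]

theorem act_injective (θ : BlockSubst ι A) (hinj : Function.Injective θ.map) :
    Function.Injective θ.act := by
  intro x y h
  funext q
  apply hinj
  funext n
  have h1 := congrFun h (θ.scale 1 q + fun i => ((n i : ℕ) : ℤ))
  have hn : (fun i => ((n i : ℕ) : ℤ)) ∈ θ.supp 1 := fun i =>
    ⟨by positivity, by rw [pow_one]; exact Int.ofNat_lt.mpr (n i).2⟩
  have hr : θ.res (fun i => ((n i : ℕ) : ℤ)) = n := by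
    funext i
    apply Fin.ext
    simp only [res]
    rw [Int.emod_eq_of_lt (by positivity) (by exact_mod_cast (n i).2), Int.toNat_natCast]
  rw [act_apply, act_apply, coarse_scale_add, res_scale_add, coarse_of_mem_supp θ hn, hr,
    add_zero] at h1
  exact h1

/-! ### Legal patterns and the shift space -/

/-- The restriction of the configuration `x` to `B` is legal. -/
abbrev LegalOn (θ : BlockSubst ι A) (B : Set (ι → ℤ)) (x : (ι → ℤ) → A) : Prop :=
  θ.Legal (fun b : B => x b)

theorem legalOn_iff (θ : BlockSubst ι A) {B : Set (ι → ℤ)} {x : (ι → ℤ) → A} :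
    θ.LegalOn B x ↔ ∃ (a : A) (k : ℕ) (t : ι → ℤ), 1 ≤ k ∧
      ∀ b ∈ B, b + t ∈ θ.supp k ∧ θ.supertile k a (b + t) = x b := by
  simp only [LegalOn, Legal, Subtype.forall]

theorem LegalOn.mono {θ : BlockSubst ι A} {B B' : Set (ι → ℤ)} {x x' : (ι → ℤ) → A}
    (h : θ.LegalOn B x) (hB : B' ⊆ B) (hx : ∀ b ∈ B', x' b = x b) : θ.LegalOn B' x' := by
  rw [legalOn_iff] at *
  obtain ⟨a, k, t, hk, h⟩ := h
  exact ⟨a, k, t, hk, fun b hb => by rw [hx b hb]; exact h b (hB hb)⟩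

theorem LegalOn.shift {θ : BlockSubst ι A} {B B' : Set (ι → ℤ)} {x : (ι → ℤ) → A}
    (h : θ.LegalOn B x) (n : ι → ℤ) (hB : ∀ b ∈ B', b + n ∈ B) :
    θ.LegalOn B' (shift n x) := by
  rw [legalOn_iff] at *
  obtain ⟨a, k, t, hk, h⟩ := h
  refine ⟨a, k, n + t, hk, fun b hb => ?_⟩
  rw [← add_assoc]
  exact h _ (hB b hb)

theorem LegalOn.act {θ : BlockSubst ι A} {B B' : Set (ι → ℤ)} {x : (ι → ℤ) → A}
    (h : θ.LegalOn B x) (hB : ∀ b ∈ B', θ.coarse 1 b ∈ B) : θ.LegalOn B' (θ.act x) := by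
  rw [legalOn_iff] at *
  obtain ⟨a, k, t, hk, h⟩ := h
  refine ⟨a, k + 1, θ.scale 1 t, by omega, fun b hb => ?_⟩
  obtain ⟨h1, h2⟩ := h _ (hB b hb)
  rw [add_comm b]
  constructor
  · rw [mem_supp_iff] at *
    rw [add_comm k 1, ← coarse_coarse, coarse_scale_add, add_comm, h1]
  · rw [← act_supertile, act_apply, act_apply, coarse_scale_add, res_scale_add, add_comm t, h2]

theorem shift_mem_shiftSpace {θ : BlockSubst ι A} {x : (ι → ℤ) → A} (hx : x ∈ θ.shiftSpace)
    (n : ι → ℤ) : shift n x ∈ θ.shiftSpace := fun _ hB =>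
  LegalOn.shift (hx _ (hB.image (· + n))) n fun b hb => ⟨b, hb, rfl⟩

theorem act_mem_shiftSpace {θ : BlockSubst ι A} {x : (ι → ℤ) → A} (hx : x ∈ θ.shiftSpace) :
    θ.act x ∈ θ.shiftSpace := fun _ hB =>
  LegalOn.act (hx _ (hB.image (θ.coarse 1))) fun b hb => ⟨b, hb, rfl⟩

theorem act_iterate_mem_shiftSpace {θ : BlockSubst ι A} {x : (ι → ℤ) → A}
    (hx : x ∈ θ.shiftSpace) (k : ℕ) : θ.act^[k] x ∈ θ.shiftSpace := by
  induction k with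
  | zero => exact hx
  | succ k ih =>
    rw [Function.iterate_succ_apply']
    exact act_mem_shiftSpace ih

/-- By primitivity, a legal pattern occurs in a supertile of level at least two, hence in the
image under `θ` of a legal pattern. -/
theorem LegalOn.exists_two_le {θ : BlockSubst ι A} (hprim : θ.IsPrimitive) {B : Set (ι → ℤ)}
    {x : (ι → ℤ) → A} (h : θ.LegalOn B x) : ∃ (a : A) (k : ℕ) (t : ι → ℤ), 1 ≤ k ∧
      ∀ b ∈ B, b + t ∈ θ.supp (k + 1) ∧ θ.supertile (k + 1) a (b + t) = x b := by
  rw [legalOn_iff] at h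
  obtain ⟨a, k, t, hk, h⟩ := h
  obtain ⟨K, hK, hp⟩ := hprim
  obtain ⟨q, hq, hqa⟩ := hp a a
  refine ⟨a, k + K - 1, θ.scale k q + t, by omega, fun b hb => ?_⟩
  obtain ⟨h1, h2⟩ := h b hb
  rw [show k + K - 1 + 1 = k + K by omega, add_left_comm]
  refine ⟨scale_add_mem_supp θ hq h1, ?_⟩
  rw [← act_iterate_const, Function.iterate_add_apply, act_iterate_const, act_iterate_scale_add,
    coarse_of_mem_supp θ h1, add_zero, hqa, h2]

/-! ### Desubstitution -/

theorem _root_.Ultrafilter.exists_eventually_eq {X Y : Type*} [Finite Y] (U : Ultrafilter X)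
    (f : X → Y) : ∃ y, ∀ᶠ x in (U : Filter X), f x = y := by
  by_contra! h
  have h1 : ∀ y, ∀ᶠ x in (U : Filter X), f x ≠ y := h
  obtain ⟨x, hx⟩ := (Filter.eventually_all.mpr h1).exists
  exact hx (f x) rfl

/-- An ultrafilter on the finite sets of positions that contains all the final segments. Limits
of configurations along it replace the compactness of `A^{ℤ^ι}`. -/
noncomputable def windowUltrafilter (ι : Type*) : Ultrafilter (Finset (ι → ℤ)) :=
  Ultrafilter.of Filter.atTop

theorem eventually_subset_window {B : Set (ι → ℤ)} (hB : B.Finite) :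
    ∀ᶠ F : Finset (ι → ℤ) in windowUltrafilter ι, B ⊆ (F : Set (ι → ℤ)) := by
  apply Ultrafilter.of_le (Filter.atTop : Filter (Finset (ι → ℤ)))
  filter_upwards [Filter.eventually_ge_atTop hB.toFinset] with F hF
  exact hB.coe_toFinset ▸ (Finset.coe_subset.mpr hF)

/-- Limits of configurations exist, and belong to the shift space when the restrictions to the
windows are legal. -/
theorem exists_window_limit [Finite A] (θ : BlockSubst ι A)
    (y : Finset (ι → ℤ) → (ι → ℤ) → A)
    (hy : ∀ F : Finset (ι → ℤ), θ.LegalOn (F : Set (ι → ℤ)) (y F)) :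
    ∃ y' ∈ θ.shiftSpace, ∀ p,
      ∀ᶠ F : Finset (ι → ℤ) in windowUltrafilter ι, y F p = y' p := by
  choose y' hy' using fun p => (windowUltrafilter ι).exists_eventually_eq fun F => y F p
  refine ⟨y', fun B hB => ?_, hy'⟩
  obtain ⟨F, hF, hF'⟩ := ((eventually_subset_window hB).and
    ((Filter.eventually_all_finite hB).mpr fun b _ => hy' b)).exists
  exact (hy F).mono hF fun b hb => (hF' b hb).symm

theorem exists_desubstitution [Finite ι] [Finite A] {θ : BlockSubst ι A} (hprim : θ.IsPrimitive)
    {x : (ι → ℤ) → A} (hx : x ∈ θ.shiftSpace) :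
    ∃ r ∈ θ.supp 1, ∃ y ∈ θ.shiftSpace, x = shift r (θ.act y) := by
  have key : ∀ F : Finset (ι → ℤ), ∃ (r : θ.supp 1) (y : (ι → ℤ) → A), 
      θ.LegalOn (F : Set (ι → ℤ)) y ∧
      ∀ p ∈ F, x p = shift r (θ.act y) p := by
    intro F
    -- the window is enlarged by the corners of the supertiles with index in `F`
    have hB : ((F : Set (ι → ℤ)) ∪
        Set.image2 (fun q r => θ.scale 1 q - r) (F : Set (ι → ℤ)) (θ.supp 1)).Finite :=
      F.finite_toSet.union (F.finite_toSet.image2 _ (θ.finite_supp 1))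
    obtain ⟨a, k, t, hk, h⟩ := LegalOn.exists_two_le hprim (hx _ hB)
    obtain ⟨r, hr, ht⟩ := θ.exists_eq_scale_add 1 t
    refine ⟨⟨r, hr⟩, shift (θ.coarse 1 t) (θ.supertile k a), ?_, ?_⟩
    · rw [legalOn_iff]
      refine ⟨a, k, θ.coarse 1 t, hk, fun q hq => ⟨?_, rfl⟩⟩
      have h1 := (h (θ.scale 1 q - r) (Or.inr ⟨q, hq, r, hr, rfl⟩)).1
      have h2 : θ.scale 1 q - r + t = θ.scale 1 (q + θ.coarse 1 t) + 0 := by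
        conv_lhs => rw [ht]
        rw [scale_add]
        abel
      have h3 : θ.coarse 1 0 = 0 := by
        funext i
        simp [coarse]
      rw [h2, mem_supp_iff, add_comm k 1, ← coarse_coarse, coarse_scale_add, h3, add_zero] at h1
      exact θ.mem_supp_of_coarse h1
    · intro p hp
      rw [act_shift, shift_shift, act_supertile, add_comm r, ← ht]
      exact (h p (Or.inl hp)).2.symm
  choose r y hy h using key
  have := (θ.finite_supp 1).to_subtype
  obtain ⟨r', hr'⟩ := (windowUltrafilter ι).exists_eventually_eq r
  obtain ⟨y', hy'X, hy'⟩ := exists_window_limit θ y hy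
  refine ⟨r', r'.2, y', hy'X, ?_⟩
  funext p
  obtain ⟨F, hF1, hF2, hF3⟩ := ((eventually_subset_window (Set.finite_singleton p)).and
    (hr'.and (hy' (θ.coarse 1 (p + r'))))).exists
  rw [h F p (by simpa using hF1)]
  simp only [shift, act_apply, hF2, hF3]

theorem exists_desubstitution_iterate [Finite ι] [Finite A] {θ : BlockSubst ι A}
    (hprim : θ.IsPrimitive) {x : (ι → ℤ) → A} (hx : x ∈ θ.shiftSpace) (k : ℕ) :
    ∃ (r : ι → ℤ), ∃ y ∈ θ.shiftSpace, x = shift r (θ.act^[k] y) := by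
  induction k with
  | zero => exact ⟨0, x, hx, by rw [shift_zero]; rfl⟩
  | succ k ih =>
    obtain ⟨r, y, hy, rfl⟩ := ih
    obtain ⟨s, -, y', hy', rfl⟩ := exists_desubstitution hprim hy
    refine ⟨r + θ.scale k s, y', hy', ?_⟩
    rw [act_iterate_shift, shift_shift, Function.iterate_succ_apply]

/-- The shift space is minimal: every finite pattern of `x` occurs in `y`. -/
theorem exists_shift_eqOn [Finite ι] [Finite A] {θ : BlockSubst ι A} (hprim : θ.IsPrimitive)
    {x y : (ι → ℤ) → A} (hx : x ∈ θ.shiftSpace) (hy : y ∈ θ.shiftSpace) {B : Set (ι → ℤ)}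
    (hB : B.Finite) : ∃ t, ∀ p ∈ B, shift t y p = x p := by
  obtain ⟨a, m, t, -, h⟩ := θ.legalOn_iff.mp (hx B hB)
  obtain ⟨K, -, hK⟩ := id hprim
  obtain ⟨r, y', -, rfl⟩ := exists_desubstitution_iterate hprim hy (m + K)
  obtain ⟨q, hq, hqa⟩ := hK (y' 0) a
  refine ⟨θ.scale m q + t - r, fun p hp => ?_⟩
  obtain ⟨h1, h2⟩ := h p hp
  rw [shift_shift, shift, sub_add_cancel, add_left_comm, Function.iterate_add_apply,
    act_iterate_scale_add, coarse_of_mem_supp θ h1, add_zero, act_iterate_apply,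
    coarse_of_mem_supp θ hq, hqa, h2]

/-! ### Recognizability -/

/-- A coincidence between two translates of `θ(𝕏)` at one point propagates, by minimality, to all
points of the shift space. -/
theorem exists_shift_act_eq_act [Finite ι] [Finite A] {θ : BlockSubst ι A}
    (hprim : θ.IsPrimitive) {x x' : (ι → ℤ) → A} (hx : x ∈ θ.shiftSpace)
    (hx' : x' ∈ θ.shiftSpace) {δ : ι → ℤ} (h : shift δ (θ.act x) = θ.act x')
    {y : (ι → ℤ) → A} (hy : y ∈ θ.shiftSpace) :
    ∃ y' ∈ θ.shiftSpace, shift δ (θ.act y) = θ.act y' := by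
  choose t ht using fun F : Finset (ι → ℤ) => exists_shift_eqOn hprim hy hx F.finite_toSet
  obtain ⟨y', hy', hlim⟩ := exists_window_limit θ (fun F => shift (t F) x')
    fun F => shift_mem_shiftSpace hx' (t F) _ F.finite_toSet
  refine ⟨y', hy', ?_⟩
  funext p
  obtain ⟨F, hF1, hF2⟩ := ((eventually_subset_window
    (Set.finite_singleton (θ.coarse 1 (p + δ)))).and (hlim (θ.coarse 1 p))).exists
  have h1 : shift δ (θ.act (shift (t F) x)) = θ.act (shift (t F) x') := by
    rw [act_shift, act_shift, ← h, shift_shift, shift_shift, add_comm]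
  have h2 := congrFun h1 p
  rw [shift, act_apply, act_apply, ht F _ (by simpa using hF1)] at h2
  rw [shift, act_apply, act_apply, h2, ← hF2]

/-- The relation `θ^k(y') = σ_s(θ^k(y))`, with `s` smaller than the level-`k` supertiles, as a local
rule: the pairs of a pattern of `y` on `{-1, 0, 1}^ι` and a letter of `y'` at the origin which it
allows. -/
def offsetRule (θ : BlockSubst ι A) (k : ℕ) (s : ι → ℤ) :
    Set ((Set.Icc (-1 : ι → ℤ) 1 → A) × A) :=
  {Pa | ∀ p ∈ θ.supp k, ∀ c : Set.Icc (-1 : ι → ℤ) 1, θ.coarse k (p + s) = c →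
    θ.supertile k Pa.2 p = θ.supertile k (Pa.1 c) (p + s)}

theorem mem_offsetRule {θ : BlockSubst ι A} {k : ℕ} {s : ι → ℤ} {y y' : (ι → ℤ) → A}
    (h : θ.act^[k] y' = shift s (θ.act^[k] y)) (n : ι → ℤ) :
    ((fun c => y (n + c), y' n) : (Set.Icc (-1 : ι → ℤ) 1 → A) × A) ∈ θ.offsetRule k s := by
  intro p hp c hc
  have h1 := congrFun h (θ.scale k n + p)
  rw [shift, add_assoc, act_iterate_scale_add, act_iterate_scale_add, coarse_of_mem_supp θ hp,
    add_zero, hc] at h1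
  exact h1

theorem coarse_sub_mem_Icc (θ : BlockSubst ι A) {k : ℕ} {p t t' : ι → ℤ} (hp : p ∈ θ.supp k)
    (ht : t ∈ θ.supp k) (ht' : t' ∈ θ.supp k) :
    θ.coarse k (p + (t - t')) ∈ Set.Icc (-1 : ι → ℤ) 1 := by
  constructor <;> intro i <;> have h := θ.len_pow_pos k i <;> have h1 := hp i <;>
    have h2 := ht i <;> have h3 := ht' i <;>
    simp only [coarse, Pi.add_apply, Pi.sub_apply, Pi.neg_apply, Pi.one_apply]
  · rw [Int.le_ediv_iff_mul_le h]
    linarith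
  · rw [← Int.lt_add_one_iff, Int.ediv_lt_iff_lt_mul h]
    linarith

theorem eq_shift_of_mem_offsetRule {θ : BlockSubst ι A} {k : ℕ} {t t' : ι → ℤ}
    {y y' : (ι → ℤ) → A} (ht : t ∈ θ.supp k) (ht' : t' ∈ θ.supp k)
    (h : ∀ n, ((fun c => y (n + c), y' n) : (Set.Icc (-1 : ι → ℤ) 1 → A) × A) ∈
      θ.offsetRule k (t - t')) :
    θ.act^[k] y' = shift (t - t') (θ.act^[k] y) := by
  funext u
  obtain ⟨p, hp, hu⟩ := θ.exists_eq_scale_add k u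
  rw [hu, shift, add_assoc, act_iterate_scale_add, act_iterate_scale_add,
    coarse_of_mem_supp θ hp, add_zero]
  exact h (θ.coarse k u) p hp ⟨_, θ.coarse_sub_mem_Icc hp ht ht'⟩ rfl

/-- The offsets `t` of the level-`k` supertiles of `x` for which `x ∈ σ_t(θ^k(𝕏))`. -/
def offsets (θ : BlockSubst ι A) (k : ℕ) (x : (ι → ℤ) → A) : Set (ι → ℤ) :=
  {t | t ∈ θ.supp k ∧ ∃ y ∈ θ.shiftSpace, x = shift t (θ.act^[k] y)}

/-- The number of level-`k` offsets of a point is bounded independently of `k`: different offsets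
are related by different local rules, because there are no periods. -/
theorem encard_offsets_le {θ : BlockSubst ι A} (haper : θ.IsAperiodic) (k : ℕ)
    (x : (ι → ℤ) → A) :
    (θ.offsets k x).encard ≤ ENat.card (Set ((Set.Icc (-1 : ι → ℤ) 1 → A) × A)) := by
  rcases (θ.offsets k x).eq_empty_or_nonempty with h0 | ⟨t₀, ht₀, y₀, hy₀, hx₀⟩
  · simp [h0]
  rw [← Set.encard_univ]
  refine Set.encard_le_encard_of_injOn (f := fun t => θ.offsetRule k (t - t₀))
    (fun _ _ => Set.mem_univ _) ?_
  rintro t ⟨ht, y, hy, hx⟩ t' ⟨ht', -⟩ heq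
  have h1 : θ.act^[k] y₀ = shift (t - t₀) (θ.act^[k] y) := by
    have h2 := congrArg (shift (-t₀)) (hx₀.symm.trans hx)
    rwa [shift_shift, shift_shift, neg_add_cancel, shift_zero, neg_add_eq_sub] at h2
  have h3 : θ.act^[k] y₀ = shift (t' - t₀) (θ.act^[k] y) := by
    refine eq_shift_of_mem_offsetRule ht' ht₀ fun n => ?_
    have h4 := mem_offsetRule h1 n
    simp only at heq
    rwa [heq] at h4
  have h5 : shift (t - t') (θ.act^[k] y) = θ.act^[k] y := by
    have h6 := congrArg (shift (-(t' - t₀))) (h1.symm.trans h3)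
    rwa [shift_shift, shift_shift, neg_add_cancel, shift_zero,
      show -(t' - t₀) + (t - t₀) = t - t' by abel] at h6
  exact sub_eq_zero.mp (haper _ (act_iterate_mem_shiftSpace hy k) _ h5)

/-- Offsets only matter modulo the lattice of level-`k` supertiles. -/
theorem exists_shift_add_scale {θ : BlockSubst ι A} {k : ℕ} {x y : (ι → ℤ) → A}
    (hy : y ∈ θ.shiftSpace) {s : ι → ℤ} (m : ι → ℤ)
    (hx : x = shift (s + θ.scale k m) (θ.act^[k] y)) :
    ∃ y' ∈ θ.shiftSpace, x = shift s (θ.act^[k] y') :=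
  ⟨shift m y, shift_mem_shiftSpace hy m, by rw [hx, act_iterate_shift, shift_shift]⟩

/-- If every point has two level-1 offsets, then the number of level-`k` offsets is exponential. -/
theorem two_pow_le_encard_offsets {θ : BlockSubst ι A}
    (h : ∀ x ∈ θ.shiftSpace, ∃ r ∈ θ.offsets 1 x, ∃ r' ∈ θ.offsets 1 x, r ≠ r') (k : ℕ)
    {x : (ι → ℤ) → A} (hx : x ∈ θ.shiftSpace) : (2 : ℕ∞) ^ k ≤ (θ.offsets k x).encard := by
  induction k generalizing x with
  | zero =>
    rw [pow_zero, Set.one_le_encard_iff_nonempty]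
    exact ⟨0, θ.mem_supp_iff.mpr (coarse_zero θ 0), x, hx, by rw [shift_zero]; rfl⟩
  | succ k ih =>
    obtain ⟨r, ⟨hr, y, hy, hxy⟩, r', ⟨hr', y', hy', hxy'⟩, hne⟩ := h x hx
    have hcoarse : ∀ t r, r ∈ θ.supp 1 → θ.scale 1 (θ.coarse 1 (θ.scale 1 t + r)) + r =
        θ.scale 1 t + r := by
      intro t r hr
      rw [coarse_scale_add, coarse_of_mem_supp θ hr, add_zero]
    have hsub : ∀ r y, r ∈ θ.supp 1 → x = shift r (θ.act^[1] y) →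
        (fun t => θ.scale 1 t + r) '' θ.offsets k y ⊆ θ.offsets (k + 1) x := by
      rintro r y hr hxy _ ⟨t, ⟨ht, w, hw, rfl⟩, rfl⟩
      refine ⟨add_comm k 1 ▸ scale_add_mem_supp θ ht hr, w, hw, ?_⟩
      rw [hxy, act_iterate_shift, shift_shift, ← Function.iterate_add_apply, add_comm r,
        add_comm k]
    have hcard : ∀ r, ∀ y ∈ θ.shiftSpace,
        (2 : ℕ∞) ^ k ≤ ((fun t => θ.scale 1 t + r) '' θ.offsets k y).encard := by
      intro r y hy
      rw [Function.Injective.encard_image]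
      · exact ih hy
      · intro t t' htt
        exact θ.scale_injective 1 (add_right_cancel htt)
    have hdisj : Disjoint ((fun t => θ.scale 1 t + r) '' θ.offsets k y)
        ((fun t => θ.scale 1 t + r') '' θ.offsets k y') := by
      rw [Set.disjoint_left]
      rintro _ ⟨t, -, rfl⟩ ⟨t', -, htt⟩
      have h1 := hcoarse t r hr
      simp only at htt
      rw [← htt, coarse_scale_add, coarse_of_mem_supp θ hr', add_zero] at h1
      exact hne (add_left_cancel h1)
    calc (2 : ℕ∞) ^ (k + 1) = 2 ^ k + 2 ^ k := by ring
      _ ≤ _ := add_le_add (hcard r y hy) (hcard r' y' hy')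
      _ = _ := (Set.encard_union_eq hdisj).symm
      _ ≤ _ := Set.encard_le_encard (Set.union_subset (hsub r y hr hxy) (hsub r' y' hr' hxy'))

/-- The level-1 supertiles of a point of the shift space are determined by the point. If not, then
some `δ ∉ Qℤ^ι` translates `θ(𝕏)` to itself, and every point has two level-1 offsets. -/
theorem exists_scale_of_shift_act_eq [Finite ι] [Finite A] {θ : BlockSubst ι A}
    (hprim : θ.IsPrimitive) (haper : θ.IsAperiodic) {y y' : (ι → ℤ) → A}
    (hy : y ∈ θ.shiftSpace) (hy' : y' ∈ θ.shiftSpace) {δ : ι → ℤ}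
    (h : shift δ (θ.act y) = θ.act y') : ∃ m, δ = θ.scale 1 m := by
  by_contra hδ
  have htwo : ∀ x ∈ θ.shiftSpace, ∃ r ∈ θ.offsets 1 x, ∃ r' ∈ θ.offsets 1 x, r ≠ r' := by
    intro x hx
    obtain ⟨r, hr, w, hw, hxw⟩ := exists_desubstitution hprim hx
    obtain ⟨w', hw', hww⟩ := exists_shift_act_eq_act hprim hy hy' h hw
    obtain ⟨r', hr', hrr⟩ := θ.exists_eq_scale_add 1 (r - δ)
    refine ⟨r, ⟨hr, w, hw, hxw⟩, r', ⟨hr', ?_⟩, ?_⟩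
    · refine exists_shift_add_scale hw' (θ.coarse 1 (r - δ)) ?_
      rw [add_comm, ← hrr, Function.iterate_one, ← hww, shift_shift, sub_add_cancel, hxw]
    · rintro rfl
      refine hδ ⟨-θ.coarse 1 (r - δ), ?_⟩
      have h1 : θ.scale 1 (-θ.coarse 1 (r - δ)) + θ.scale 1 (θ.coarse 1 (r - δ)) = 0 := by
        rw [← scale_add, neg_add_cancel]
        funext i
        simp [scale]
      have h2 : θ.scale 1 (θ.coarse 1 (r - δ)) = -δ := by
        have h3 : r - δ = -δ + r := by abel
        exact (add_right_cancel (h3.symm.trans hrr)).symm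
      rw [h2] at h1
      exact (add_neg_eq_zero.mp h1).symm
  set S := Set ((Set.Icc (-1 : ι → ℤ) 1 → A) × A)
  have hfin : (Set.Icc (-1 : ι → ℤ) 1).Finite := by
    refine (Set.Finite.pi' fun _ : ι => Set.finite_Icc (-1 : ℤ) 1).subset ?_
    exact fun p hp i => ⟨hp.1 i, hp.2 i⟩
  have := hfin.to_subtype
  have hS : Finite S := inferInstance
  have h1 := (two_pow_le_encard_offsets htwo (Nat.card S) hy).trans (encard_offsets_le haper _ y)
  rw [ENat.card_eq_coe_natCard] at h1
  exact (Nat.lt_two_pow_self (n := Nat.card S)).not_ge (by exact_mod_cast h1)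

/-- Recognizability at level `k`. -/
theorem exists_scale_of_shift_act_iterate_eq [Finite ι] [Finite A] {θ : BlockSubst ι A}
    (hinj : Function.Injective θ.map) (hprim : θ.IsPrimitive) (haper : θ.IsAperiodic) (k : ℕ)
    {y y' : (ι → ℤ) → A} (hy : y ∈ θ.shiftSpace) (hy' : y' ∈ θ.shiftSpace) {δ : ι → ℤ}
    (h : shift δ (θ.act^[k] y) = θ.act^[k] y') : ∃ m, δ = θ.scale k m := by
  induction k generalizing δ with
  | zero => exact ⟨δ, (scale_zero θ δ).symm⟩
  | succ k ih =>
    rw [Function.iterate_succ_apply', Function.iterate_succ_apply'] at h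
    obtain ⟨m, rfl⟩ := exists_scale_of_shift_act_eq hprim haper
      (act_iterate_mem_shiftSpace hy k) (act_iterate_mem_shiftSpace hy' k) h
    rw [← act_shift] at h
    obtain ⟨m', rfl⟩ := ih (θ.act_injective hinj h)
    exact ⟨m', by rw [scale_scale, add_comm]⟩

end BlockSubst

/-! ### Truncations and digits of `ℓ`-adic integers -/

namespace AdicInt

variable {ℓ : ℕ}

theorem intCast_trunc (hℓ : 2 ≤ ℓ) (z : AdicInt ℓ) (k : ℕ) :
    (((z.trunc k : ℕ) : ℤ) : ZMod (ℓ ^ k)) = z.proj k := by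
  have : NeZero (ℓ ^ k) := ⟨pow_ne_zero _ (by omega)⟩
  rw [trunc, Int.cast_natCast, ZMod.natCast_zmod_val]

theorem trunc_lt (hℓ : 2 ≤ ℓ) (z : AdicInt ℓ) (k : ℕ) : z.trunc k < ℓ ^ k := by
  have : NeZero (ℓ ^ k) := ⟨pow_ne_zero _ (by omega)⟩
  exact ZMod.val_lt _

theorem ext_proj {z z' : AdicInt ℓ} (h : ∀ k, z.proj k = z'.proj k) : z = z' := by
  cases z
  cases z'
  congr
  exact funext h

theorem ext_trunc (hℓ : 2 ≤ ℓ) {z z' : AdicInt ℓ} (h : ∀ k, z.trunc k = z'.trunc k) : z = z' :=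
  ext_proj fun k => by rw [← intCast_trunc hℓ, ← intCast_trunc hℓ, h]

theorem trunc_succ_mod (hℓ : 2 ≤ ℓ) (z : AdicInt ℓ) (k : ℕ) :
    z.trunc (k + 1) % ℓ ^ k = z.trunc k := by
  have : NeZero (ℓ ^ (k + 1)) := ⟨pow_ne_zero _ (by omega)⟩
  rw [trunc, trunc, ← z.compat k, ZMod.castHom_apply, ZMod.cast_eq_val, ZMod.val_natCast]

theorem trunc_succ (hℓ : 2 ≤ ℓ) (z : AdicInt ℓ) (k : ℕ) :
    z.trunc (k + 1) = z.trunc k + ℓ ^ k * (z.digit hℓ k : ℕ) := by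
  rw [← trunc_succ_mod hℓ z k]
  exact (Nat.mod_add_div _ _).symm

theorem exists_trunc_eq (hℓ : 2 ≤ ℓ) (S : ℕ → ℤ) (h0 : ∀ k, 0 ≤ S k)
    (hlt : ∀ k, S k < (ℓ : ℤ) ^ k) (hS : ∀ k, (ℓ : ℤ) ^ k ∣ S (k + 1) - S k) :
    ∃ z : AdicInt ℓ, ∀ k, (z.trunc k : ℤ) = S k := by
  refine ⟨⟨fun k => (S k : ZMod (ℓ ^ k)), fun k => ?_⟩, fun k => ?_⟩
  · rw [map_intCast, eq_comm, ZMod.intCast_eq_intCast_iff_dvd_sub]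
    exact_mod_cast hS k
  · have : NeZero (ℓ ^ k) := ⟨pow_ne_zero _ (by omega)⟩
    rw [trunc, ZMod.val_intCast]
    push_cast
    exact Int.emod_eq_of_lt (h0 k) (hlt k)

theorem dvd_trunc_ofInt (hℓ : 2 ≤ ℓ) (N : ℤ) (k : ℕ) :
    (ℓ : ℤ) ^ k ∣ (ofInt ℓ N).trunc k - N := by
  have h := intCast_trunc hℓ (ofInt ℓ N) k
  rw [ofInt, eq_comm, ZMod.intCast_eq_intCast_iff_dvd_sub] at h
  exact_mod_cast h

theorem isInteger_of_dvd (hℓ : 2 ≤ ℓ) {z : AdicInt ℓ} {N : ℤ} {K : ℕ}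
    (h : ∀ k ≥ K, (ℓ : ℤ) ^ k ∣ z.trunc k - N) : z.IsInteger := by
  have hproj : ∀ k ≥ K, (ofInt ℓ N).proj k = z.proj k := by
    intro k hk
    rw [← intCast_trunc hℓ z, ofInt, ZMod.intCast_eq_intCast_iff_dvd_sub]
    exact_mod_cast h k hk
  refine ⟨N, ext_proj fun k => ?_⟩
  rcases le_total K k with hk | hk
  · exact hproj k hk
  · -- the lower projections are determined by the projection at level `K`
    exact Nat.decreasingInduction (motive := fun k _ => (ofInt ℓ N).proj k = z.proj k)
      (fun k _ ih => by rw [← compat, ih, compat]) (hproj K le_rfl) hk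

/-- Digits that are eventually `0` belong to the nonnegative integers. -/
theorem frequently_digit_ne_zero (hℓ : 2 ≤ ℓ) {z : AdicInt ℓ} (hz : ¬ z.IsInteger) (K : ℕ) :
    ∃ k ≥ K, (z.digit hℓ k : ℕ) ≠ 0 := by
  by_contra! h
  refine hz (isInteger_of_dvd hℓ (N := z.trunc K) (K := K) fun k hk => ?_)
  have : z.trunc k = z.trunc K := by
    induction k, hk using Nat.le_induction with
    | base => rfl
    | succ k hk ih => rw [trunc_succ hℓ, h k hk, ih, mul_zero, add_zero]
  rw [this, sub_self]
  exact dvd_zero _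

/-- Digits that are eventually `ℓ - 1` belong to the negative integers. -/
theorem frequently_digit_ne_last (hℓ : 2 ≤ ℓ) {z : AdicInt ℓ} (hz : ¬ z.IsInteger) (K : ℕ) :
    ∃ k ≥ K, ((z.digit hℓ k : ℕ) : ℤ) ≠ ℓ - 1 := by
  by_contra! h
  refine hz (isInteger_of_dvd hℓ (N := z.trunc K - (ℓ : ℤ) ^ K) (K := K) fun k hk => ?_)
  have : (z.trunc k : ℤ) - (ℓ : ℤ) ^ k = z.trunc K - (ℓ : ℤ) ^ K := by
    induction k, hk using Nat.le_induction with
    | base => rfl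
    | succ k hk ih =>
      rw [trunc_succ hℓ, ← ih]
      push_cast
      rw [h k hk]
      ring
  rw [← this]
  exact ⟨1, by ring⟩

end AdicInt

namespace BlockSubst

variable {ι A : Type*}

/-! ### Tile addresses -/

theorem trunc_mem_supp (θ : BlockSubst ι A) (z : θ.Odometer) (k : ℕ) :
    (fun i => ((z i).trunc k : ℤ)) ∈ θ.supp k := fun i =>
  ⟨by positivity,
    (Int.ofNat_lt.mpr ((z i).trunc_lt (θ.two_le_len i) k)).trans_eq (by push_cast; rfl)⟩

theorem IsTileAddress.unique [Finite ι] [Finite A] {θ : BlockSubst ι A}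
    (hinj : Function.Injective θ.map) (hprim : θ.IsPrimitive) (haper : θ.IsAperiodic)
    {x : (ι → ℤ) → A} {z z' : θ.Odometer} (h : θ.IsTileAddress x z)
    (h' : θ.IsTileAddress x z') : z = z' := by
  funext i
  refine AdicInt.ext_trunc (θ.two_le_len i) fun k => ?_
  obtain ⟨y, hy, hxy⟩ := h k
  obtain ⟨y', hy', hxy'⟩ := h' k
  set t : ι → ℤ := fun i => ((z i).trunc k : ℤ)
  set t' : ι → ℤ := fun i => ((z' i).trunc k : ℤ)
  have h1 : shift (-t' + t) (θ.act^[k] y) = θ.act^[k] y' := by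
    have h2 := congrArg (shift (-t')) (hxy.symm.trans hxy')
    rwa [shift_shift, shift_shift, neg_add_cancel, shift_zero] at h2
  obtain ⟨m, hm⟩ := exists_scale_of_shift_act_iterate_eq hinj hprim haper k hy hy' h1
  have h3 : t = θ.scale k m + t' := by
    rw [← hm]
    abel
  have h4 := coarse_of_mem_supp θ (trunc_mem_supp θ z k)
  change θ.coarse k t = 0 at h4
  rw [h3, coarse_scale_add, coarse_of_mem_supp θ (trunc_mem_supp θ z' k), add_zero] at h4
  have h5 : t i = t' i := by
    rw [h3, h4]
    simp [scale]
  exact Int.ofNat_inj.mp h5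

theorem exists_isTileAddress [Finite ι] [Finite A] {θ : BlockSubst ι A}
    (hprim : θ.IsPrimitive) {x : (ι → ℤ) → A} (hx : x ∈ θ.shiftSpace) :
    ∃ z, θ.IsTileAddress x z := by
  choose r hr y hy hxy using fun x : θ.shiftSpace => exists_desubstitution hprim x.2
  let Y : ℕ → θ.shiftSpace := fun k => (fun x => ⟨y x, hy x⟩)^[k] ⟨x, hx⟩
  have hY : ∀ k, (Y k : (ι → ℤ) → A) = shift (r (Y k)) (θ.act (Y (k + 1))) := by
    intro k
    have h1 : Y (k + 1) = ⟨y (Y k), hy (Y k)⟩ := Function.iterate_succ_apply' _ _ _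
    rw [h1]
    exact hxy (Y k)
  let S : ℕ → ι → ℤ := fun k => Nat.rec 0 (fun k s => θ.scale k (r (Y k)) + s) k
  have hS0 : S 0 = 0 := rfl
  have hS : ∀ k, S (k + 1) = θ.scale k (r (Y k)) + S k := fun k => rfl
  have hSsupp : ∀ k, S k ∈ θ.supp k := by
    intro k
    induction k with
    | zero => exact θ.mem_supp_iff.mpr (coarse_zero θ 0)
    | succ k ih => exact scale_add_mem_supp θ (hr _) ih
  have hxS : ∀ k, x = shift (S k) (θ.act^[k] (Y k)) := by
    intro k
    induction k with
    | zero => rw [hS0, shift_zero]; rfl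
    | succ k ih =>
      rw [hS, Function.iterate_succ_apply, add_comm, ← shift_shift, ← act_iterate_shift, ← hY]
      exact ih
  choose z hz using fun i => AdicInt.exists_trunc_eq (θ.two_le_len i) (fun k => S k i)
    (fun k => (hSsupp k i).1) (fun k => (hSsupp k i).2) (fun k => ⟨r (Y k) i, by
      simp only [hS, Pi.add_apply, scale]
      ring⟩)
  refine ⟨z, fun k => ⟨Y k, (Y k).2, ?_⟩⟩
  have hz' : (fun i => ((z i).trunc k : ℤ)) = S k := funext fun i => hz i k
  rw [hz']
  exact hxS k

/-- By recognizability, the fibre of the tiling factor over `z` consists of the points with tile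
address `z`. -/
theorem piTile_eq_iff [Finite ι] [Finite A] {θ : BlockSubst ι A}
    (hinj : Function.Injective θ.map) (hprim : θ.IsPrimitive) (haper : θ.IsAperiodic)
    (x : θ.shiftSpace) (z : θ.Odometer) : θ.piTile x = z ↔ θ.IsTileAddress x z := by
  have h : θ.IsTileAddress x (θ.piTile x) :=
    Classical.epsilon_spec (exists_isTileAddress hprim x.2)
  exact ⟨fun hz => hz ▸ h, fun hz => IsTileAddress.unique hinj hprim haper h hz⟩

/-- The sequences `y 0, y 1, …` in the shift space in which each term is the desubstitution of the
preceding one with offset `e k`. -/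
def desubstitutions (θ : BlockSubst ι A) (e : ℕ → ι → ℤ) : Set (ℕ → θ.shiftSpace) :=
  {y | ∀ k, (y k : (ι → ℤ) → A) = shift (e k) (θ.act (y (k + 1)))}

/-- The truncations of the address may be replaced by any sequence of representatives modulo the
supertile lattices. -/
theorem isTileAddress_iff {θ : BlockSubst ι A} (hinj : Function.Injective θ.map)
    {x : (ι → ℤ) → A} {z : θ.Odometer} {s e : ℕ → ι → ℤ}
    (hs : ∀ k, s (k + 1) = s k + θ.scale k (e k))
    (hz : ∀ k, ∃ m, (fun i => ((z i).trunc k : ℤ)) = s k + θ.scale k m) :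
    θ.IsTileAddress x z ↔ ∃ y ∈ θ.desubstitutions e, x = shift (s 0) (y 0) := by
  constructor
  · intro h
    have h1 : ∀ k, ∃ y : θ.shiftSpace, x = shift (s k) (θ.act^[k] y) := by
      intro k
      obtain ⟨y, hy, hxy⟩ := h k
      obtain ⟨m, hm⟩ := hz k
      rw [hm] at hxy
      obtain ⟨y', hy', hxy'⟩ := exists_shift_add_scale hy m hxy
      exact ⟨⟨y', hy'⟩, hxy'⟩
    choose y hy using h1
    refine ⟨y, fun k => ?_, hy 0⟩
    have h2 := (hy k).symm.trans (hy (k + 1))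
    rw [hs, Function.iterate_succ_apply, ← shift_shift, ← act_iterate_shift] at h2
    have h3 := congrArg (shift (-s k)) h2
    rw [shift_shift, shift_shift, neg_add_cancel, shift_zero, shift_zero] at h3
    exact (θ.act_injective hinj).iterate k h3
  · rintro ⟨y, hy, rfl⟩ k
    have h1 : ∀ k, shift (s 0) (y 0 : (ι → ℤ) → A) = shift (s k) (θ.act^[k] (y k)) := by
      intro k
      induction k with
      | zero => rfl
      | succ k ih =>
        rw [ih, hs, Function.iterate_succ_apply, ← shift_shift, ← act_iterate_shift, ← hy k]
    obtain ⟨m, hm⟩ := hz k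
    refine exists_shift_add_scale (y k).2 (-m) ?_
    rw [h1 k, hm, add_assoc, ← scale_add, add_neg_cancel]
    congr 1
    funext i
    simp [scale]

theorem desubstitutions_injOn {θ : BlockSubst ι A} (hinj : Function.Injective θ.map)
    (e : ℕ → ι → ℤ) (n : ι → ℤ) :
    Set.InjOn (fun y : ℕ → θ.shiftSpace => shift n (y 0 : (ι → ℤ) → A))
      (θ.desubstitutions e) := by
  have hshift : ∀ (n : ι → ℤ) {x x' : (ι → ℤ) → A}, shift n x = shift n x' → x = x' := by
    intro n x x' h
    have h1 := congrArg (shift (-n)) h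
    rwa [shift_shift, shift_shift, neg_add_cancel, shift_zero, shift_zero] at h1
  intro y hy y' hy' h
  funext k
  induction k with
  | zero => exact Subtype.ext (hshift n h)
  | succ k ih =>
    have h1 := hy k
    rw [ih, hy' k] at h1
    exact Subtype.ext (θ.act_injective hinj (hshift _ h1)).symm

/-! ### Desubstitutions and their patterns at the corner -/

/-- The offset whose coordinates are `n` outside `J` and zero in `J`. -/
noncomputable def cornerOffset (θ : BlockSubst ι A) (J : Set ι)
    (n : ∀ j : {j // j ∉ J}, Fin (θ.len j)) : ι → ℤ := by
  classical
  exact fun i => if h : i ∈ J then 0 else ((n ⟨i, h⟩ : ℕ) : ℤ)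

theorem cornerOffset_of_mem (θ : BlockSubst ι A) {J : Set ι}
    (n : ∀ j : {j // j ∉ J}, Fin (θ.len j)) {i : ι} (hi : i ∈ J) : θ.cornerOffset J n i = 0 := by
  simp [cornerOffset, hi]

theorem cornerOffset_of_notMem (θ : BlockSubst ι A) {J : Set ι}
    (n : ∀ j : {j // j ∉ J}, Fin (θ.len j)) {i : ι} (hi : i ∉ J) :
    θ.cornerOffset J n i = ((n ⟨i, hi⟩ : ℕ) : ℤ) := by
  simp [cornerOffset, hi]

theorem cornerOffset_nonneg (θ : BlockSubst ι A) {J : Set ι}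
    (n : ∀ j : {j // j ∉ J}, Fin (θ.len j)) (i : ι) : 0 ≤ θ.cornerOffset J n i := by
  by_cases hi : i ∈ J
  · rw [cornerOffset_of_mem θ n hi]
  · rw [cornerOffset_of_notMem θ n hi]
    positivity

theorem cornerOffset_lt (θ : BlockSubst ι A) {J : Set ι}
    (n : ∀ j : {j // j ∉ J}, Fin (θ.len j)) (i : ι) : θ.cornerOffset J n i < θ.len i := by
  by_cases hi : i ∈ J
  · rw [cornerOffset_of_mem θ n hi]
    exact θ.len_pos i
  · rw [cornerOffset_of_notMem θ n hi]
    exact Int.ofNat_lt.mpr (n ⟨i, hi⟩).2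

theorem coarse_add_cornerOffset (θ : BlockSubst ι A) {J : Set ι}
    (n : ∀ j : {j // j ∉ J}, Fin (θ.len j)) {b : ι → ℤ} (hb : b ∈ cornerBox J) :
    θ.coarse 1 (b + θ.cornerOffset J n) = b := by
  funext i
  have h2 := θ.two_le_len i
  simp only [coarse, pow_one, Pi.add_apply]
  by_cases hi : i ∈ J
  · rw [cornerOffset_of_mem θ n hi, add_zero]
    rcases hb.1 i hi with h | h <;> rw [h]
    · exact Int.ediv_eq_neg_one_of_neg_of_le (by omega) (by omega)
    · exact Int.zero_ediv _
  · rw [hb.2 i hi, zero_add]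
    exact Int.ediv_eq_zero_of_lt (cornerOffset_nonneg θ n i) (cornerOffset_lt θ n i)

theorem res_add_cornerOffset (θ : BlockSubst ι A) {J : Set ι}
    (n : ∀ j : {j // j ∉ J}, Fin (θ.len j)) {b : ι → ℤ} (hb : b ∈ cornerBox J) :
    θ.res (b + θ.cornerOffset J n) = θ.cornerDigit J n b := by
  funext i
  have h2 := θ.two_le_len i
  apply Fin.ext
  simp only [res, Pi.add_apply]
  by_cases hi : i ∈ J
  · rw [cornerOffset_of_mem θ n hi, add_zero]
    rcases hb.1 i hi with h | h <;> rw [h]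
    · have h3 : (-1 : ℤ) % θ.len i = θ.len i - 1 := by
        rw [Int.emod_def, Int.ediv_eq_neg_one_of_neg_of_le (by omega) (by omega)]
        ring
      simp only [cornerDigit, hi, h, dif_pos, if_pos, h3]
      omega
    · simp [cornerDigit, hi, h]
  · rw [hb.2 i hi, zero_add,
      Int.emod_eq_of_lt (cornerOffset_nonneg θ n i) (cornerOffset_lt θ n i),
      cornerOffset_of_notMem θ n hi]
    simp [cornerDigit, hi]

theorem finite_cornerBox [Finite ι] (J : Set ι) : (cornerBox J).Finite := by
  refine (Set.Finite.pi' fun _ : ι => Set.finite_Icc (-1 : ℤ) 0).subset fun b hb i => ?_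
  by_cases hi : i ∈ J
  · rcases hb.1 i hi with h | h <;> simp [h]
  · simp [hb.2 i hi]

/-- The index of the level-`m` supertile that contains `p`, for the supertile structure of
`σ_{e k} θ σ_{e (k + 1)} θ ⋯ σ_{e (k + m - 1)} θ`. -/
def carry (θ : BlockSubst ι A) (e : ℕ → ι → ℤ) : ℕ → ℕ → (ι → ℤ) → ι → ℤ
  | 0, _, p => p
  | m + 1, k, p => θ.carry e m (k + 1) (θ.coarse 1 (p + e k))

theorem carry_succ' (θ : BlockSubst ι A) (e : ℕ → ι → ℤ) (m k : ℕ) (p : ι → ℤ) :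
    θ.carry e (m + 1) k p = θ.coarse 1 (θ.carry e m k p + e (k + m)) := by
  induction m generalizing k p with
  | zero => rfl
  | succ m ih =>
    rw [carry, ih, carry, show k + 1 + m = k + (m + 1) by omega]

theorem carry_add_succ (θ : BlockSubst ι A) (e : ℕ → ι → ℤ) (m k : ℕ) (p : ι → ℤ) (i : ι) :
    θ.carry e (m + 1) k p i = (θ.carry e m k p i + e (k + m) i) / θ.len i := by
  rw [carry_succ', coarse, pow_one, Pi.add_apply]

end BlockSubst

/-- Dividing by `ℓ` with carries below `ℓ` contracts to `{-1, 0, 1}`. -/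
theorem exists_forall_mem_Icc_of_div {ℓ : ℤ} (hℓ : 2 ≤ ℓ) {u a : ℕ → ℤ} (h0 : ∀ m, 0 ≤ a m)
    (hlt : ∀ m, a m < ℓ) (hu : ∀ m, u (m + 1) = (u m + a m) / ℓ) :
    ∃ M, ∀ m ≥ M, -1 ≤ u m ∧ u m ≤ 1 := by
  have hdiv : ∀ m, ∃ r, 0 ≤ r ∧ r < ℓ ∧ u m + a m = ℓ * u (m + 1) + r := fun m =>
    ⟨(u m + a m) % ℓ, Int.emod_nonneg _ (by omega), Int.emod_lt_of_pos _ (by omega), by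
      rw [hu, Int.mul_ediv_add_emod]⟩
  have hstay : ∀ m, -1 ≤ u m ∧ u m ≤ 1 → -1 ≤ u (m + 1) ∧ u (m + 1) ≤ 1 := by
    intro m hm
    obtain ⟨r, hr0, hr1, hr⟩ := hdiv m
    have := h0 m
    have := hlt m
    constructor <;> nlinarith
  have hdecr : ∀ m, ¬ (-1 ≤ u m ∧ u m ≤ 1) → (u (m + 1)).natAbs < (u m).natAbs := by
    intro m hm
    obtain ⟨r, hr0, hr1, hr⟩ := hdiv m
    have := h0 m
    have := hlt m
    rcases lt_or_ge 1 (u m) with h | h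
    · have h1 : 0 ≤ u (m + 1) := by nlinarith
      have h2 : u (m + 1) < u m := by nlinarith
      omega
    · have h3 : u m ≤ -2 := by omega
      have h1 : u (m + 1) ≤ 0 := by nlinarith
      have h2 : u m < u (m + 1) := by nlinarith
      omega
  have hreach : ∀ n m, (u m).natAbs ≤ n → ∃ M, -1 ≤ u M ∧ u M ≤ 1 := by
    intro n
    induction n with
    | zero => exact fun m hm => ⟨m, by omega, by omega⟩
    | succ n ih =>
      intro m hm
      by_cases h : -1 ≤ u m ∧ u m ≤ 1
      · exact ⟨m, h⟩
      · exact ih (m + 1) (by have := hdecr m h; omega)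
  obtain ⟨M, hM⟩ := hreach _ 0 le_rfl
  refine ⟨M, fun m hm => ?_⟩
  induction m, hm using Nat.le_induction with
  | base => exact hM
  | succ m _ ih => exact hstay m ih

theorem exists_forall_eq_of_div_zero {ℓ : ℤ} (hℓ : 2 ≤ ℓ) {u : ℕ → ℤ}
    (hu : ∀ m, u (m + 1) = u m / ℓ) : ∃ M, ∀ m ≥ M, u m = -1 ∨ u m = 0 := by
  obtain ⟨M, hM⟩ := exists_forall_mem_Icc_of_div hℓ (u := u) (a := fun _ => 0) (fun _ => le_rfl)
    (fun _ => by omega) (fun m => by rw [hu, add_zero])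
  refine ⟨M + 1, fun m hm => ?_⟩
  obtain ⟨m, rfl⟩ : ∃ m', m = m' + 1 := ⟨m - 1, by omega⟩
  have h1 := (hM (m + 1) (by omega)).1
  have h2 := (hM m (by omega)).2
  have h3 : u (m + 1) ≤ 0 := by
    rw [hu, ← Int.lt_add_one_iff, Int.ediv_lt_iff_lt_mul (by omega)]
    omega
  omega

/-- The value `1` survives only while the carry is `ℓ - 1`, and `-1` only while it is `0`. -/
theorem exists_forall_eq_zero_of_div {ℓ : ℤ} (hℓ : 2 ≤ ℓ) {u a : ℕ → ℤ} (h0 : ∀ m, 0 ≤ a m)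
    (hlt : ∀ m, a m < ℓ) (hu : ∀ m, u (m + 1) = (u m + a m) / ℓ)
    (hzero : ∀ M, ∃ m ≥ M, a m ≠ 0) (hlast : ∀ M, ∃ m ≥ M, a m ≠ ℓ - 1) :
    ∃ M, ∀ m ≥ M, u m = 0 := by
  have hdiv0 : ∀ m, 0 ≤ u m + a m → u m + a m < ℓ → u (m + 1) = 0 := fun m h1 h2 => by
    rw [hu, Int.ediv_eq_zero_of_lt h1 h2]
  obtain ⟨M, hM⟩ := exists_forall_mem_Icc_of_div hℓ h0 hlt hu
  obtain ⟨m, -, hm⟩ : ∃ m ≥ M, u m = 0 := by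
    by_contra! hne
    obtain ⟨m, hmM, hm⟩ := hzero M
    have h1 : ∀ m' ≥ m, u m' = 1 := by
      intro m' hm'
      induction m', hm' using Nat.le_induction with
      | base =>
        by_contra hne1
        have := hM m hmM
        have := hne m hmM
        have := h0 m
        have := hlt m
        exact hne (m + 1) (by omega) (hdiv0 m (by omega) (by omega))
      | succ m' hm' ih =>
        have := hM (m' + 1) (by omega)
        have := hne (m' + 1) (by omega)
        have h3 : 0 ≤ u (m' + 1) := by
          rw [hu]
          exact Int.ediv_nonneg (by have := h0 m'; omega) (by omega)
        omega
    obtain ⟨m', hm', hl⟩ := hlast m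
    have := h0 m'
    have := hlt m'
    have := h1 m' hm'
    exact hne (m' + 1) (by omega) (hdiv0 m' (by omega) (by omega))
  refine ⟨m, fun m' hm' => ?_⟩
  induction m', hm' using Nat.le_induction with
  | base => exact hm
  | succ m' _ ih =>
    exact hdiv0 m' (by rw [ih, zero_add]; exact h0 m') (by rw [ih, zero_add]; exact hlt m')

namespace BlockSubst

variable {ι A : Type*}

/-- The supertiles with indices in the corner box exhaust `ℤ^ι` if the digits outside `J` are those
of non-integers. -/
theorem eventually_carry_mem_cornerBox [Finite ι] (θ : BlockSubst ι A) {J : Set ι}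
    (n : ℕ → ∀ j : {j // j ∉ J}, Fin (θ.len j))
    (hzero : ∀ j M, ∃ m ≥ M, (n m j : ℕ) ≠ 0)
    (hlast : ∀ j M, ∃ m ≥ M, ((n m j : ℕ) : ℤ) ≠ θ.len j - 1) (k : ℕ) (p : ι → ℤ) :
    ∀ᶠ m in Filter.atTop, θ.carry (fun k => θ.cornerOffset J (n k)) m k p ∈ cornerBox J := by
  set e := fun k => θ.cornerOffset J (n k)
  have h2 : ∀ i, (2 : ℤ) ≤ θ.len i := fun i => by exact_mod_cast θ.two_le_len i
  have h1 : ∀ i, ∀ᶠ m in Filter.atTop,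
      (i ∈ J → θ.carry e m k p i = -1 ∨ θ.carry e m k p i = 0) ∧
        (i ∉ J → θ.carry e m k p i = 0) := by
    intro i
    rw [Filter.eventually_atTop]
    by_cases hi : i ∈ J
    · obtain ⟨M, hM⟩ := exists_forall_eq_of_div_zero (h2 i) (u := fun m => θ.carry e m k p i)
        fun m => by
          rw [carry_add_succ, show e (k + m) i = 0 from cornerOffset_of_mem θ _ hi, add_zero]
      exact ⟨M, fun m hm => ⟨fun _ => hM m hm, fun h => absurd hi h⟩⟩
    · have hei : ∀ m, e m i = ((n m ⟨i, hi⟩ : ℕ) : ℤ) := fun m => cornerOffset_of_notMem θ _ hi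
      have hzero' : ∀ M, ∃ m ≥ M, e (k + m) i ≠ 0 := by
        intro M
        obtain ⟨m, hm, h⟩ := hzero ⟨i, hi⟩ (k + M)
        refine ⟨m - k, by omega, ?_⟩
        rw [Nat.add_sub_cancel' (by omega), hei]
        exact_mod_cast h
      have hlast' : ∀ M, ∃ m ≥ M, e (k + m) i ≠ θ.len i - 1 := by
        intro M
        obtain ⟨m, hm, h⟩ := hlast ⟨i, hi⟩ (k + M)
        refine ⟨m - k, by omega, ?_⟩
        rw [Nat.add_sub_cancel' (by omega), hei]
        exact h
      obtain ⟨M, hM⟩ := exists_forall_eq_zero_of_div (h2 i) (u := fun m => θ.carry e m k p i)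
        (a := fun m => e (k + m) i) (fun m => cornerOffset_nonneg θ _ i)
        (fun m => cornerOffset_lt θ _ i) (fun m => carry_add_succ θ e m k p i) hzero' hlast'
      exact ⟨M, fun m hm => ⟨fun h => absurd h hi, fun _ => hM m hm⟩⟩
  filter_upwards [Filter.eventually_all.mpr h1] with m hm
  exact ⟨fun j hj => (hm j).1 hj, fun j hj => (hm j).2 hj⟩

/-- The pattern of `x` on the corner box. -/
def cornerPattern [Finite ι] (θ : BlockSubst ι A) (J : Set ι) (x : θ.shiftSpace) :
    θ.DerivedLetter J :=
  ⟨fun b => x.1 b, x.2 _ (finite_cornerBox J)⟩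

/-- The inverse limit of the columns `n 0, n 1, …` of a block substitution. -/
def columnLimit (θ : BlockSubst ι A) (n : ℕ → ∀ i, Fin (θ.len i)) : Set (ℕ → A) :=
  {P | ∀ k, P k = θ.map (P (k + 1)) (n k)}

theorem shift_act_corner (θ : BlockSubst ι A) {J : Set ι}
    (n : ∀ j : {j // j ∉ J}, Fin (θ.len j)) (x : (ι → ℤ) → A) {b : ι → ℤ}
    (hb : b ∈ cornerBox J) :
    shift (θ.cornerOffset J n) (θ.act x) b = θ.map (x b) (θ.cornerDigit J n b) := by
  rw [shift, act_apply, coarse_add_cornerOffset θ n hb, res_add_cornerOffset θ n hb]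

/-- The level-`m` approximation of a desubstitution with corner patterns `w k`. -/
def approx (θ : BlockSubst ι A) (e : ℕ → ι → ℤ) (w : ℕ → (ι → ℤ) → A) :
    ℕ → ℕ → (ι → ℤ) → A
  | 0, k => w k
  | m + 1, k => shift (e k) (θ.act (θ.approx e w m (k + 1)))

theorem approx_succ_eq (θ : BlockSubst ι A) {J : Set ι} {e : ℕ → ι → ℤ}
    {w : ℕ → (ι → ℤ) → A}
    (hw : ∀ k, ∀ b ∈ cornerBox J, w k b = shift (e k) (θ.act (w (k + 1))) b) (m k : ℕ)
    {p : ι → ℤ} (hp : θ.carry e m k p ∈ cornerBox J) :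
    θ.approx e w m k p = θ.approx e w (m + 1) k p := by
  induction m generalizing k p with
  | zero => exact hw k p hp
  | succ m ih =>
    rw [approx, approx, shift, act_apply, shift, act_apply, ih (k + 1) hp]

theorem legalOn_approx (θ : BlockSubst ι A) {J : Set ι} {e : ℕ → ι → ℤ}
    {w : ℕ → (ι → ℤ) → A} (hw : ∀ k, θ.LegalOn (cornerBox J) (w k)) (m k : ℕ) :
    θ.LegalOn {p | θ.carry e m k p ∈ cornerBox J} (θ.approx e w m k) := by
  induction m generalizing k with
  | zero => exact hw k
  | succ m ih =>
    refine LegalOn.shift (B := {p | θ.carry e m (k + 1) (θ.coarse 1 p) ∈ cornerBox J})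
      (LegalOn.act (ih (k + 1)) fun b hb => hb) (e k) fun b hb => hb

/-- The desubstitutions with the given offsets are determined by their patterns on the corner box,
and every sequence of legal patterns that is compatible with the derived substitution arises. -/
theorem bijOn_cornerPattern [Finite ι] (θ : BlockSubst ι A) {J : Set ι}
    (n : ℕ → ∀ j : {j // j ∉ J}, Fin (θ.len j))
    (hzero : ∀ j M, ∃ m ≥ M, (n m j : ℕ) ≠ 0)
    (hlast : ∀ j M, ∃ m ≥ M, ((n m j : ℕ) : ℤ) ≠ θ.len j - 1) :
    Set.BijOn (fun y k => θ.cornerPattern J (y k))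
      (θ.desubstitutions fun k => θ.cornerOffset J (n k)) ((θ.derived J).columnLimit n) := by
  have hev := eventually_carry_mem_cornerBox θ n hzero hlast
  set e : ℕ → ι → ℤ := fun k => θ.cornerOffset J (n k) with he
  refine ⟨?_, ?_, ?_⟩
  · intro y hy k
    apply Subtype.ext
    funext b
    have h1 := congrFun (hy k) b
    rw [shift_act_corner θ (n k) _ b.2] at h1
    exact h1
  · intro y hy y' hy' h
    have h1 : ∀ m k p, θ.carry e m k p ∈ cornerBox J → (y k).1 p = (y' k).1 p := by
      intro m
      induction m with
      | zero =>
        intro k p hp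
        exact congrFun (congrArg Subtype.val (congrFun h k)) ⟨p, hp⟩
      | succ m ih =>
        intro k p hp
        rw [hy k, hy' k, shift, shift, act_apply, act_apply, ih (k + 1) _ hp]
    funext k
    apply Subtype.ext
    funext p
    obtain ⟨m, hm⟩ := (hev k p).exists
    exact h1 m k p hm
  · intro P hP
    have h0 : (0 : ι → ℤ) ∈ cornerBox J := ⟨fun _ _ => Or.inr rfl, fun _ _ => rfl⟩
    classical
    -- the patterns are extended to configurations by an arbitrary letter
    let w : ℕ → (ι → ℤ) → A := fun k p =>
      if h : p ∈ cornerBox J then (P k).1 ⟨p, h⟩ else (P k).1 ⟨0, h0⟩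
    have hwP : ∀ k b, (hb : b ∈ cornerBox J) → w k b = (P k).1 ⟨b, hb⟩ := fun k b hb =>
      dif_pos hb
    have hwlegal : ∀ k, θ.LegalOn (cornerBox J) (w k) := by
      intro k
      have h1 : (fun b : cornerBox J => w k b) = (P k).1 := funext fun b => hwP k b b.2
      rw [LegalOn, h1]
      exact (P k).2
    have hw : ∀ k, ∀ b ∈ cornerBox J, w k b = shift (e k) (θ.act (w (k + 1))) b := by
      intro k b hb
      rw [he, shift_act_corner θ (n k) _ hb, hwP k b hb, hwP (k + 1) b hb, hP k]
      rfl
    have hstay : ∀ m k p, θ.carry e m k p ∈ cornerBox J →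
        θ.carry e (m + 1) k p ∈ cornerBox J := by
      intro m k p hp
      rw [carry_succ', he, coarse_add_cornerOffset θ _ hp]
      exact hp
    have hlim : ∀ k p, ∃ a, ∀ᶠ m in Filter.atTop, θ.approx e w m k p = a := by
      intro k p
      obtain ⟨M, hM⟩ := (hev k p).exists
      refine ⟨θ.approx e w M k p, Filter.eventually_atTop.mpr ⟨M, fun m hm => ?_⟩⟩
      have h1 : θ.carry e m k p ∈ cornerBox J ∧ θ.approx e w m k p = θ.approx e w M k p := by
        induction m, hm using Nat.le_induction with
        | base => exact ⟨hM, rfl⟩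
        | succ m _ ih =>
          exact ⟨hstay m k p ih.1, (approx_succ_eq θ hw m k ih.1).symm.trans ih.2⟩
      exact h1.2
    choose y hy using hlim
    have hyX : ∀ k, y k ∈ θ.shiftSpace := by
      intro k B hB
      obtain ⟨m, hm1, hm2⟩ := (((Filter.eventually_all_finite hB).mpr fun b _ => hev k b).and
        ((Filter.eventually_all_finite hB).mpr fun b _ => hy k b)).exists
      exact (legalOn_approx θ hwlegal m k).mono hm1 fun b hb => (hm2 b hb).symm
    refine ⟨fun k => ⟨y k, hyX k⟩, fun k => ?_, ?_⟩
    · funext p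
      obtain ⟨m, hm1, hm2⟩ := (((Filter.tendsto_add_atTop_nat 1).eventually (hy k p)).and
        (hy (k + 1) (θ.coarse 1 (p + e k)))).exists
      change y k p = shift (e k) (θ.act (y (k + 1))) p
      rw [← hm1, approx, shift, act_apply, hm2, shift, act_apply]
    · funext k
      apply Subtype.ext
      funext b
      have h1 : ∀ m, θ.carry e m k b ∈ cornerBox J ∧ θ.approx e w m k b = w k b := by
        intro m
        induction m with
        | zero => exact ⟨b.2, rfl⟩
        | succ m ih =>
          exact ⟨hstay m k b ih.1, (approx_succ_eq θ hw m k ih.1).symm.trans ih.2⟩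
      obtain ⟨m, hm⟩ := (hy k b).exists
      change y k b = (P k).1 b
      rw [← hm, (h1 m).2, hwP k b b.2]

/-! ### Paths in the reversed coincidence graph -/

theorem isInfinitePath_op_iff (θ : BlockSubst ι A) (n : ℕ → ∀ i, Fin (θ.len i))
    (v : ℕ → Set A) : θ.coincidenceGraph.op.IsInfinitePath n v ↔
      ∀ k, θ.IsCoincidenceVertex (v (k + 1)) ∧ v k = (fun a => θ.map a (n k)) '' v (k + 1) :=
  Iff.rfl

/-- Every letter of a vertex on the path extends to a point of the inverse limit: preimages are
chosen step by step above the vertex, and images are taken below. -/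
theorem exists_mem_columnLimit (θ : BlockSubst ι A) {n : ℕ → ∀ i, Fin (θ.len i)}
    {v : ℕ → Set A} (hv : ∀ k, v k = (fun a => θ.map a (n k)) '' v (k + 1)) {k : ℕ} {a : A}
    (ha : a ∈ v k) : ∃ P ∈ θ.columnLimit n, P k = a := by
  induction k generalizing n v with
  | zero =>
    have h1 : ∀ k, ∀ a : v k, ∃ b : v (k + 1), (a : A) = θ.map b (n k) := by
      rintro k ⟨a, ha⟩
      rw [hv k] at ha
      obtain ⟨b, hb, rfl⟩ := ha
      exact ⟨⟨b, hb⟩, rfl⟩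
    choose f hf using h1
    let P : ∀ k, v k := fun k => Nat.rec (motive := fun k => v k) ⟨a, ha⟩ f k
    exact ⟨fun k => (P k : A), fun k => hf k (P k), rfl⟩
  | succ k ih =>
    obtain ⟨P, hP, hPk⟩ := ih (n := fun k => n (k + 1)) (v := fun k => v (k + 1))
      (fun k => hv (k + 1)) ha
    refine ⟨fun k => Nat.casesOn k (θ.map (P 0) (n 0)) P, fun k => ?_, hPk⟩
    cases k with
    | zero => rfl
    | succ k => exact hP k

/-- The image of the alphabet under the composition of the columns `n k, …, n (k + m - 1)`. -/
def columnImage (θ : BlockSubst ι A) (n : ℕ → ∀ i, Fin (θ.len i)) : ℕ → ℕ → Set A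
  | 0, _ => Set.univ
  | m + 1, k => (fun a => θ.map a (n k)) '' θ.columnImage n m (k + 1)

theorem isCoincidenceVertex_columnImage (θ : BlockSubst ι A) (n : ℕ → ∀ i, Fin (θ.len i))
    (m k : ℕ) : θ.IsCoincidenceVertex (θ.columnImage n m k) := by
  induction m generalizing k with
  | zero => exact .alphabet
  | succ m ih => exact .column _ _ (ih (k + 1))

theorem columnImage_succ_subset (θ : BlockSubst ι A) (n : ℕ → ∀ i, Fin (θ.len i)) (m k : ℕ) :
    θ.columnImage n (m + 1) k ⊆ θ.columnImage n m k := by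
  induction m generalizing k with
  | zero => exact Set.subset_univ _
  | succ m ih => exact Set.image_mono (ih (k + 1))

theorem mem_columnImage {θ : BlockSubst ι A} {n : ℕ → ∀ i, Fin (θ.len i)} {P : ℕ → A}
    (hP : P ∈ θ.columnLimit n) (m k : ℕ) : P k ∈ θ.columnImage n m k := by
  induction m generalizing k with
  | zero => exact Set.mem_univ _
  | succ m ih => exact ⟨P (k + 1), ih (k + 1), (hP k).symm⟩

theorem eventually_columnImage_eq [Finite A] (θ : BlockSubst ι A)
    (n : ℕ → ∀ i, Fin (θ.len i)) (k : ℕ) :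
    ∃ V, ∀ᶠ m in Filter.atTop, θ.columnImage n m k = V := by
  obtain ⟨M, hM⟩ := WellFoundedGT.monotone_chain_condition (α := (Set A)ᵒᵈ)
    ⟨fun m => OrderDual.toDual (θ.columnImage n m k),
      monotone_nat_of_le_succ fun m => columnImage_succ_subset θ n m k⟩
  exact ⟨θ.columnImage n M k, Filter.eventually_atTop.mpr ⟨M, fun m hm => (hM m hm).symm⟩⟩

/-- Different points of the inverse limit differ in all coordinates from some index on. -/
theorem eventually_injOn_columnLimit (θ : BlockSubst ι A) {n : ℕ → ∀ i, Fin (θ.len i)}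
    {S : Set (ℕ → A)} (hS : S ⊆ θ.columnLimit n) (hfin : S.Finite) :
    ∀ᶠ k in Filter.atTop, Set.InjOn (fun P : ℕ → A => P k) S := by
  have h1 : ∀ P ∈ S, ∀ P' ∈ S, ∀ᶠ k in Filter.atTop, P k = P' k → P = P' := by
    intro P hP P' hP'
    by_cases h : P = P'
    · exact Filter.Eventually.of_forall fun _ _ => h
    · obtain ⟨j, hj⟩ := Function.ne_iff.mp h
      refine Filter.eventually_atTop.mpr ⟨j, fun k hk hk' => absurd hk' ?_⟩
      clear hk'
      induction k, hk using Nat.le_induction with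
      | base => exact hj
      | succ k _ ih =>
        intro h2
        exact ih (by rw [hS hP k, hS hP' k, h2])
  filter_upwards [(Filter.eventually_all_finite hfin).mpr fun P hP =>
    (Filter.eventually_all_finite hfin).mpr fun P' hP' => h1 P hP P' hP'] with k hk
  exact fun P hP P' hP' h => hk P hP P' hP' h

/-- The inverse limit of a sequence of columns has at least `C` points if and only if the columns
label a path in the reversed coincidence graph that meets infinitely many vertices with at least
`C` elements. -/
theorem le_encard_columnLimit_iff [Finite A] (θ : BlockSubst ι A)
    (n : ℕ → ∀ i, Fin (θ.len i)) (C : ℕ) :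
    (C : ℕ∞) ≤ (θ.columnLimit n).encard ↔
      ∃ v : ℕ → Set A, θ.coincidenceGraph.op.IsInfinitePath n v ∧
        ∃ᶠ k in Filter.atTop, (C : ℕ∞) ≤ (v k).encard := by
  simp only [isInfinitePath_op_iff]
  constructor
  · intro hC
    choose v hv using eventually_columnImage_eq θ n
    refine ⟨v, fun k => ⟨?_, ?_⟩, Filter.Eventually.frequently ?_⟩
    · obtain ⟨m, hm⟩ := (hv (k + 1)).exists
      exact hm ▸ isCoincidenceVertex_columnImage θ n m (k + 1)
    · obtain ⟨m, hm1, hm2⟩ := (((Filter.tendsto_add_atTop_nat 1).eventually (hv k)).and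
        (hv (k + 1))).exists
      rw [← hm1, ← hm2, columnImage]
    · obtain ⟨S, hS, hcard⟩ := Set.exists_subset_encard_eq hC
      have hfin : S.Finite := Set.finite_of_encard_eq_coe hcard
      filter_upwards [eventually_injOn_columnLimit θ hS hfin] with k hk
      obtain ⟨m, hm⟩ := (hv k).exists
      rw [← hcard, ← hm]
      exact Set.encard_le_encard_of_injOn (fun P hP => mem_columnImage (hS hP) m k) hk
  · rintro ⟨v, hv, hC⟩
    obtain ⟨k, hk⟩ := hC.exists
    have h1 : v k ⊆ (fun P : ℕ → A => P k) '' θ.columnLimit n := fun a ha =>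
      exists_mem_columnLimit θ (fun k => (hv k).2) ha
    exact hk.trans ((Set.encard_le_encard h1).trans (Set.encard_image_le _ _))

/-! ### The fibres of the tiling factor -/

theorem finite_derivedLetter [Finite ι] [Finite A] (θ : BlockSubst ι A) (J : Set ι) :
    Finite (θ.DerivedLetter J) := by
  have := (finite_cornerBox J).to_subtype
  exact Subtype.finite

/-- The fibre over `z` is in bijection with the inverse limit of the columns of the derived
substitution that are given by the digits of the non-integer coordinates of `z`. -/
theorem encard_preimage_piTile [Finite ι] [Finite A] {θ : BlockSubst ι A}
    (hinj : Function.Injective θ.map) (hprim : θ.IsPrimitive) (haper : θ.IsAperiodic)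
    (z : θ.Odometer) {J : Set ι} (hJ : J = {j | (z j).IsInteger}) :
    (θ.piTile ⁻¹' {z}).encard = ((θ.derived J).columnLimit (θ.digitLabel J z)).encard := by
  classical
  have hint : ∀ i, ∃ N : ℤ, i ∈ J → AdicInt.ofInt (θ.len i) N = z i := by
    intro i
    by_cases hi : i ∈ J
    · obtain ⟨N, hN⟩ : (z i).IsInteger := by rwa [hJ] at hi
      exact ⟨N, fun _ => hN⟩
    · exact ⟨0, fun h => absurd h hi⟩
  choose N hN using hint
  have hnint : ∀ j : {j // j ∉ J}, ¬ (z j).IsInteger := by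
    rintro ⟨j, hj⟩
    rwa [hJ] at hj
  -- in the directions of `J` the integers themselves represent all the truncations
  let s : ℕ → ι → ℤ := fun k i => if i ∈ J then N i else ((z i).trunc k : ℤ)
  let e : ℕ → ι → ℤ := fun k => θ.cornerOffset J (θ.digitLabel J z k)
  have hs : ∀ k, s (k + 1) = s k + θ.scale k (e k) := by
    intro k
    funext i
    by_cases hi : i ∈ J
    · simp [s, e, scale, hi, cornerOffset_of_mem]
    · simp only [s, e, scale, hi, if_false, Pi.add_apply, cornerOffset_of_notMem θ _ hi,
        digitLabel]
      rw [(z i).trunc_succ (θ.two_le_len i)]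
      push_cast
      rfl
  have hz : ∀ k, ∃ m, (fun i => ((z i).trunc k : ℤ)) = s k + θ.scale k m := by
    intro k
    have h1 : ∀ i, ∃ m : ℤ, ((z i).trunc k : ℤ) = s k i + (θ.len i : ℤ) ^ k * m := by
      intro i
      by_cases hi : i ∈ J
      · obtain ⟨m, hm⟩ := AdicInt.dvd_trunc_ofInt (θ.two_le_len i) (N i) k
        refine ⟨m, ?_⟩
        rw [hN i hi] at hm
        simp only [s, hi, if_true]
        rw [← hm]
        ring
      · exact ⟨0, by simp [s, hi]⟩
    choose m hm using h1
    exact ⟨m, funext hm⟩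
  have himage : Subtype.val '' (θ.piTile ⁻¹' {z}) =
      (fun y : ℕ → θ.shiftSpace => shift (s 0) (y 0 : (ι → ℤ) → A)) '' θ.desubstitutions e := by
    ext x
    constructor
    · rintro ⟨x, hx, rfl⟩
      obtain ⟨y, hy, hxy⟩ :=
        (isTileAddress_iff hinj hs hz).mp ((piTile_eq_iff hinj hprim haper x z).mp hx)
      exact ⟨y, hy, hxy.symm⟩
    · rintro ⟨y, hy, rfl⟩
      refine ⟨⟨_, shift_mem_shiftSpace (y 0).2 (s 0)⟩, ?_, rfl⟩
      exact (piTile_eq_iff hinj hprim haper _ z).mpr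
        ((isTileAddress_iff hinj hs hz).mpr ⟨y, hy, rfl⟩)
  have hbij := bijOn_cornerPattern θ (θ.digitLabel J z)
    (fun j M => AdicInt.frequently_digit_ne_zero (θ.two_le_len j) (hnint j) M)
    (fun j M => AdicInt.frequently_digit_ne_last (θ.two_le_len j) (hnint j) M)
  rw [← Subtype.val_injective.encard_image, himage,
    (desubstitutions_injOn hinj e (s 0)).encard_image, ← hbij.image_eq, hbij.injOn.encard_image]

end BlockSubst

theorem mainTheorem5 {d : ℕ} {A : Type*} [Finite A] (θ : BlockSubst (Fin d) A)
    (hinj : Function.Injective θ.map) (hprim : θ.IsPrimitive) (haper : θ.IsAperiodic)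
    (z : θ.Odometer) (J : Set (Fin d)) (hJ : J = {j | (z j).IsInteger}) (hJne : J ≠ Set.univ)
    (C : ℕ) :
    (C : ℕ∞) ≤ (θ.piTile ⁻¹' {z}).encard ↔
      ∃ v : ℕ → Set (θ.DerivedLetter J),
        (θ.derived J).coincidenceGraph.op.IsInfinitePath (θ.digitLabel J z) v ∧
          ∃ᶠ k in Filter.atTop, (C : ℕ∞) ≤ (v k).encard := by
  have := BlockSubst.finite_derivedLetter θ J
  rw [BlockSubst.encard_preimage_piTile hinj hprim haper z hJ]
  exact BlockSubst.le_encard_columnLimit_iff (θ.derived J) (θ.digitLabel J z) C
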